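/- **Conventions.** Let $n\in\mathbb N$; $\mathbb R^n$ carries its Euclidean norm. A subspace of $\mathbb R^n$ is *rational* if it has a basis of vectors with rational coordinates; $\mathfrak R_n(e)$ is the set of rational subspaces of dimension $e$. The *height* $H(B)$ of a rational subspace $B$ is the Euclidean norm of a vector of coprime integers representing its Plücker coordinates. For integers $d,e$ put $g(d,e,n)=\max(0,d+e-n)$, and $g(A,e)=g(\dim A,e,n)$ for a subspace $A$. A subspace $A$ of dimension $d$ is *$(e,j)$-irrational*, where $1\le j\le \min(d,e)-g(d,e,n)$, if $\dim(A\cap B)<j+g(d,e,n)$ for all $B\in\mathfrak R_n(e)$. For nonzero $X,Y\in\mathbb R^n$ put $\omega(X,Y)=\|X\wedge Y\|/(\|X\|\,\|Y\|)$. For subspaces $A,B$ the numbers $\omega_1(A,B),\ldots,\omega_{t}(A,B)$, $t=\min(\dim A,\dim B)$, are defined inductively: $\omega_{i+1}(A,B)$ is the minimum of $\omega(X,Y)$ over nonzero $X\in A$ orthogonal to $X_1,\dots,X_i$ and nonzero $Y\in B$ orthogonal to $Y_1,\dots,Y_i$, and $(X_{i+1},Y_{i+1})$ is a pair at which it is attained.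 Put $\psi_j(A,B)=\omega_{j+g(\dim A,\dim B,n)}(A,B)$. If $1 \le d,e\le n-1$ and $A$ is $(e,j)$-irrational of dimension $d$, then $\mu_n(A|e)_j\in[0,+\infty]$ is the supremum of the set of $\mu>0$ such that $\psi_j(A,B)\le H(B)^{-\mu}$ for infinitely many $B\in\mathfrak R_n(e)$. **Theorem.** Let $1\le d\le\lfloor n/2\rfloor$, let $R_1,\ldots,R_d$ be rational subspaces of $\mathbb R^n$ that are in direct sum, and for each $j$ let $A_j\subset R_j$ be a subspace with $\dim A_j=1$. Put $A=\bigoplus_{j=1}^d A_j$ and $A_J=\bigoplus_{j\in J}A_j$ for $J\subset\{1,\ldots,d\}$. Let $1\le e\le n-1$ and $1\le k\le\min(d,e)-g(A,e)$. The following are equivalent: (i) $A$ is $(e,k)$-irrational; (ii) for every $J\subset\{1,\ldots,d\}$ with $\#J=k+g(A,e)$, the subspace $A_J$ is $(e,\,k+g(A,e)-g(A_J,e))$-irrational. Furthermore, in this case $$\mu_n(A|e)_k=\max_{J\subset\{1,\ldots,d\},\ \#J=k+g(A,e)}\ \mu_n(A_J|e)_{k+g(A,e)-g(A_J,e)}.$$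 -/

import Mathlib

namespace DiophSub

open Module

/-- The Euclidean space `ℝⁿ`. -/
abbrev E (n : ℕ) : Type := EuclideanSpace ℝ (Fin n)

/-- `g(d, e, n) = max(0, d + e - n)`; the subtraction of natural numbers truncates at `0`. -/
def g (d e n : ℕ) : ℕ := d + e - n

/-- The coordinate of `v₁ ∧ ⋯ ∧ vₘ` (Grassmann or Plücker coordinate) indexed by
`S₁ < ⋯ < Sₘ`: the minor of the matrix of the `vᵢ` on the coordinates `S₁, …, Sₘ`. -/
def plucker {n m : ℕ} (v : Fin m → E n) (S : Fin m ↪o Fin n) : ℝ :=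
  (Matrix.of fun i j => v i (S j)).det

/-- The Euclidean norm `‖v₁ ∧ ⋯ ∧ vₘ‖` of the vector of all these coordinates. -/
noncomputable def wedgeNorm {n m : ℕ} (v : Fin m → E n) : ℝ :=
  √(∑ S : Fin m ↪o Fin n, plucker v S ^ 2)

/-- A subspace of `ℝⁿ` is rational if it has a basis of vectors with rational coordinates. -/
def IsRational {n : ℕ} (B : Submodule ℝ (E n)) : Prop :=
  ∃ b : Basis (Fin (finrank ℝ B)) ℝ B, ∀ i j, ∃ q : ℚ, (b i : E n) j = q

/-- `RationalSubspaces n e` is the set of rational subspaces of dimension `e` of `ℝⁿ`. -/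
def RationalSubspaces (n e : ℕ) : Set (Submodule ℝ (E n)) :=
  {B | IsRational B ∧ finrank ℝ B = e}

/-- `η` is a vector of coprime integers that represents the point of projective space given by
the Plücker coordinates of `B`. -/
def IsPrimitivePlucker {n : ℕ} (B : Submodule ℝ (E n))
    (η : (Fin (finrank ℝ B) ↪o Fin n) → ℤ) : Prop :=
  Finset.univ.gcd η = 1 ∧
    ∃ (b : Basis (Fin (finrank ℝ B)) ℝ B) (c : ℝ), c ≠ 0 ∧
      ∀ S, (η S : ℝ) = c * plucker (fun i => (b i : E n)) S

/-- The height of a rational subspace: the Euclidean norm of a representative of its Plücker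
coordinates with coprime integer entries (such a representative is unique up to sign). -/
noncomputable def height {n : ℕ} (B : Submodule ℝ (E n)) : ℝ :=
  √(∑ S, ((Classical.epsilon (IsPrimitivePlucker B)) S : ℝ) ^ 2)

/-- `A` is `(e, j)`-irrational. -/
def IsIrrational {n : ℕ} (A : Submodule ℝ (E n)) (e j : ℕ) : Prop :=
  ∀ B ∈ RationalSubspaces n e, finrank ℝ ↥(A ⊓ B) < j + g (finrank ℝ A) e n

/-- `ω(X, Y) = ‖X ∧ Y‖ / (‖X‖ ‖Y‖)`, the sine of the angle between two nonzero vectors. -/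
noncomputable def omega {n : ℕ} (X Y : E n) : ℝ :=
  wedgeNorm ![X, Y] / (‖X‖ * ‖Y‖)

/-- `(X, Y)` realizes the minimum of `ω` on `(A \ {0}) × (B \ {0})`. -/
def IsMinPair {n : ℕ} (A B : Submodule ℝ (E n)) (p : E n × E n) : Prop :=
  (p.1 ∈ A ∧ p.1 ≠ 0) ∧ (p.2 ∈ B ∧ p.2 ≠ 0) ∧
    ∀ X ∈ A, X ≠ 0 → ∀ Y ∈ B, Y ≠ 0 → omega p.1 p.2 ≤ omega X Y

/-- A choice of a pair that realizes the minimum of `ω` (it exists as soon as `A` and `B` are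
nonzero, see `exists_isMinPair`). -/
noncomputable def minPair {n : ℕ} (A B : Submodule ℝ (E n)) : E n × E n :=
  Classical.epsilon (IsMinPair A B)

/-- The successive angles `ω₁(A, B), ω₂(A, B), …`: the first one is the minimum of `ω`, realized
by `(X₁, Y₁)`, and the later ones are those of the orthogonal complements of `X₁` in `A` and of
`Y₁` in `B`. They are meaningful for `1 ≤ j ≤ min (dim A) (dim B)`. -/
noncomputable def angle {n : ℕ} : ℕ → Submodule ℝ (E n) → Submodule ℝ (E n) → ℝ
  | 0, _, _ => 0
  | 1, A, B => omega (minPair A B).1 (minPair A B).2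
  | j + 2, A, B =>
      angle (j + 1) (A ⊓ (Submodule.span ℝ {(minPair A B).1})ᗮ)
        (B ⊓ (Submodule.span ℝ {(minPair A B).2})ᗮ)

/-- `ψⱼ(A, B) = ω_{j + g(dim A, dim B, n)}(A, B)`. -/
noncomputable def psi {n : ℕ} (j : ℕ) (A B : Submodule ℝ (E n)) : ℝ :=
  angle (j + g (finrank ℝ A) (finrank ℝ B) n) A B

/-- The Diophantine exponent `μₙ(A|e)ⱼ`, in `[0, ∞]`: the supremum of the `μ > 0` such that
`ψⱼ(A, B) ≤ H(B)^{-μ}` for infinitely many rational subspaces `B` of dimension `e`. -/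
noncomputable def exponent {n : ℕ} (A : Submodule ℝ (E n)) (e j : ℕ) : ENNReal :=
  sSup (ENNReal.ofReal ''
    {μ : ℝ | 0 < μ ∧ {B ∈ RationalSubspaces n e | psi j A B ≤ height B ^ (-μ)}.Infinite})

/-- The partial sum `A_J` of a family of subspaces. -/
def partialSum {n d : ℕ} (L : Fin d → Submodule ℝ (E n)) (J : Finset (Fin d)) :
    Submodule ℝ (E n) :=
  ⨆ j ∈ J, L j

/-! ### The choices made above are possible -/

theorem plucker_smul {n m : ℕ} (c : Fin m → ℝ) (v : Fin m → E n) (S : Fin m ↪o Fin n) :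
    plucker (fun i => c i • v i) S = (∏ i, c i) * plucker v S := by
  unfold plucker
  rw [← Matrix.det_mul_column]
  rfl

theorem wedgeNorm_smul {n m : ℕ} (c : Fin m → ℝ) (v : Fin m → E n) :
    wedgeNorm (fun i => c i • v i) = |∏ i, c i| * wedgeNorm v := by
  unfold wedgeNorm
  simp only [plucker_smul, mul_pow, ← Finset.mul_sum]
  rw [Real.sqrt_mul (sq_nonneg _), Real.sqrt_sq_eq_abs]

theorem omega_smul {n : ℕ} (X Y : E n) {a b : ℝ} (ha : 0 < a) (hb : 0 < b) :
    omega (a • X) (b • Y) = omega X Y := by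
  have h : (![a • X, b • Y] : Fin 2 → E n) = fun i => (![a, b] i) • (![X, Y] i) := by
    funext i; fin_cases i <;> rfl
  unfold omega
  rw [h, wedgeNorm_smul, norm_smul, norm_smul, Real.norm_of_nonneg ha.le,
    Real.norm_of_nonneg hb.le]
  simp only [Fin.prod_univ_two, Matrix.cons_val_zero, Matrix.cons_val_one]
  rw [abs_of_pos (mul_pos ha hb), mul_mul_mul_comm, mul_div_mul_left _ _ (mul_pos ha hb).ne']

theorem continuous_wedgeNorm_pair {n : ℕ} :
    Continuous fun p : E n × E n => wedgeNorm ![p.1, p.2] := by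
  unfold wedgeNorm plucker
  simp only [Matrix.det_fin_two, Matrix.of_apply, Matrix.cons_val_zero, Matrix.cons_val_one]
  fun_prop

theorem exists_isMinPair {n : ℕ} {A B : Submodule ℝ (E n)} (hA : A ≠ ⊥) (hB : B ≠ ⊥) :
    ∃ p, IsMinPair A B p := by
  have key : ∀ C : Submodule ℝ (E n), C ≠ ⊥ →
      IsCompact (Metric.sphere (0 : E n) 1 ∩ C) ∧ (Metric.sphere (0 : E n) 1 ∩ C).Nonempty := by
    intro C hC
    refine ⟨(isCompact_sphere _ _).inter_right C.closed_of_finiteDimensional, ?_⟩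
    obtain ⟨x, hx, hx0⟩ := Submodule.exists_mem_ne_zero_of_ne_bot hC
    refine ⟨‖x‖⁻¹ • x, ?_, C.smul_mem _ hx⟩
    simp [norm_smul, hx0]
  obtain ⟨⟨X, Y⟩, ⟨⟨hX1, hXA⟩, hY1, hYB⟩, hmin⟩ :=
    ((key A hA).1.prod (key B hB).1).exists_isMinOn ((key A hA).2.prod (key B hB).2)
      continuous_wedgeNorm_pair.continuousOn
  have hX1' : ‖X‖ = 1 := by simpa using hX1
  have hY1' : ‖Y‖ = 1 := by simpa using hY1
  refine ⟨(X, Y), ⟨hXA, ?_⟩, ⟨hYB, ?_⟩, ?_⟩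
  · rintro rfl; simp at hX1'
  · rintro rfl; simp at hY1'
  intro U hU hU0 V hV hV0
  have hu : 0 < ‖U‖⁻¹ := inv_pos.2 (norm_pos_iff.2 hU0)
  have hv : 0 < ‖V‖⁻¹ := inv_pos.2 (norm_pos_iff.2 hV0)
  rw [← omega_smul U V hu hv]
  have h1 : ‖‖U‖⁻¹ • U‖ = 1 := by simp [norm_smul, hU0]
  have h2 : ‖‖V‖⁻¹ • V‖ = 1 := by simp [norm_smul, hV0]
  have := hmin (a := (‖U‖⁻¹ • U, ‖V‖⁻¹ • V))
    ⟨⟨by simpa using h1, A.smul_mem _ hU⟩, by simpa using h2, B.smul_mem _ hV⟩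
  rw [Set.mem_ofPred_eq] at this
  simpa only [omega, h1, h2, hX1', hY1', mul_one, div_one] using this

theorem exists_plucker_ne_zero {n m : ℕ} {v : Fin m → E n} (hv : LinearIndependent ℝ v) :
    ∃ S, plucker v S ≠ 0 := by
  classical
  set M : Matrix (Fin m) (Fin n) ℝ := Matrix.of fun i j => v i j with hM
  have hrow : LinearIndependent ℝ M.row :=
    hv.map' (WithLp.linearEquiv 2 ℝ (Fin n → ℝ)).toLinearMap (LinearEquiv.ker _)
  have hrank : M.rank = m := by simpa using hrow.rank_matrix
  obtain ⟨κ, a, ha, hspan, hli⟩ := exists_linearIndependent' ℝ M.col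
  have : Finite κ := Finite.of_injective a ha
  have := Fintype.ofFinite κ
  have hcard : Fintype.card κ = m := by
    rw [← hrank, Matrix.rank_eq_finrank_span_cols, ← hspan, finrank_span_eq_card hli]
  set T : Finset (Fin n) := Finset.univ.image a with hT
  have hTcard : T.card = m := by
    rw [hT, Finset.card_image_of_injective _ ha, Finset.card_univ, hcard]
  refine ⟨T.orderEmbOfFin hTcard, ?_⟩
  have hmem : ∀ i : Fin m, ∃ x, a x = T.orderEmbOfFin hTcard i := fun i => by
    obtain ⟨x, -, hx⟩ := Finset.mem_image.1 (T.orderEmbOfFin_mem hTcard i)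
    exact ⟨x, hx⟩
  choose f hf using hmem
  have hfinj : Function.Injective f := fun i j hij =>
    (T.orderEmbOfFin hTcard).injective (by rw [← hf i, ← hf j, hij])
  have hcol : LinearIndependent ℝ
      (Matrix.of fun i j => v i (T.orderEmbOfFin hTcard j) : Matrix (Fin m) (Fin m) ℝ).col := by
    have h := hli.comp f hfinj
    have heq : (M.col ∘ a) ∘ f = (Matrix.of fun i j => v i (T.orderEmbOfFin hTcard j) :
        Matrix (Fin m) (Fin m) ℝ).col := by
      funext j i
      simp only [Function.comp_apply, hf]
      rfl
    rwa [heq] at h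
  exact ((Matrix.isUnit_iff_isUnit_det _).1
    (Matrix.linearIndependent_cols_iff_isUnit.1 hcol)).ne_zero

theorem exists_isPrimitivePlucker {n : ℕ} {B : Submodule ℝ (E n)} (hB : IsRational B) :
    ∃ η, IsPrimitivePlucker B η := by
  obtain ⟨b, hb⟩ := hB
  choose q hq using hb
  set v : Fin (finrank ℝ B) → E n := fun i => (b i : E n) with hv
  have hvli : LinearIndependent ℝ v := b.linearIndependent.map' B.subtype (by simp)
  obtain ⟨S₀, hS₀⟩ := exists_plucker_ne_zero hvli
  set p : (Fin (finrank ℝ B) ↪o Fin n) → ℚ := fun S => (Matrix.of fun i j => q i (S j)).det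
  have hp : ∀ S, plucker v S = p S := by
    intro S
    have := RingHom.map_det (Rat.castHom ℝ) (Matrix.of fun i j => q i (S j))
    simp only [eq_ratCast] at this
    rw [this]
    unfold plucker
    congr 1
    ext i j
    simp [hv, hq]
  obtain ⟨⟨D, hD⟩, hDp⟩ := IsLocalization.exist_integer_multiples_of_finite (nonZeroDivisors ℤ) p
  choose z hz using hDp
  have hD0 : (D : ℝ) ≠ 0 := by exact_mod_cast nonZeroDivisors.ne_zero hD
  have hz' : ∀ S, (z S : ℝ) = D * plucker v S := by
    intro S
    have := hz S
    simp only [algebraMap_int_eq, eq_intCast, Algebra.smul_def] at this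
    rw [hp]
    exact_mod_cast this
  have hz0 : z S₀ ≠ 0 := by
    intro h
    have := hz' S₀
    rw [h] at this
    simp [hD0, hS₀] at this
  have hG : Finset.univ.gcd z ≠ 0 := fun h =>
    hz0 (Finset.gcd_eq_zero_iff.1 h S₀ (Finset.mem_univ _))
  have hG' : ((Finset.univ.gcd z : ℤ) : ℝ) ≠ 0 := by exact_mod_cast hG
  refine ⟨fun S => z S / Finset.univ.gcd z, Finset.gcd_div_eq_one (Finset.mem_univ S₀) hz0, b,
    D / (Finset.univ.gcd z : ℤ), div_ne_zero hD0 hG', fun S => ?_⟩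
  rw [Int.cast_div (Finset.gcd_dvd (Finset.mem_univ S)) hG', hz']
  ring

end DiophSub

open DiophSub

namespace DiophSub

open Module

/-! ### The angle of two vectors -/

/-! Put `l = k + g(A, e)`. Every `ψ` in the statement is then an `l`-th angle, of `A` or of some
`A_J` with `#J = l`. Up to a factor `l`, the angle `ω_l(A, B)` is the least `ε` for which `A`
contains a subspace `V` of dimension `l` all of whose vectors `x` lie within `ε‖x‖` of `B`
(`exists_le_of_angle`, `angle_le_of_forall`). Since `A_J ⊂ A`, a subspace `V` of `A_J` serves for
`A` too, with the same `B`; hence the exponent of `A` is at least that of each `A_J`.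

Conversely, let `V ⊂ A` have dimension `l` and be close to `B`. In coordinates along generators
`u_j` of the lines `A_j`, choose `J` so that the minor of `V` on `J` is maximal. By Cramer's rule
`V` is the graph of a map with bounded coefficients over the coordinates in `J`
(`exists_dominant_coordinates`). As the `R_j` are rational and independent, a rational map is the
identity on `R_j` for `j ∈ J` and kills the other `R_j`; it carries `V` onto `A_J` with bounded
distortion, so `A_J` is close to the image of `B`. If that image has lost dimension, adding a
bounded integer matrix yields a rational `B'` of dimension `e` containing it. Only finitely many
matrices occur, so `H(B') ≤ C H(B)` uniformly (`exists_transfer`).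

With `ε = 0` this transfer gives the equivalence of irrationality conditions. For exponents,
pigeonhole fixes `J`, and irrationality together with the finiteness of subspaces of bounded height
ensures that infinitely many `B'` occur (`exponent_le_iSup`). -/

theorem sum_orderEmb_fin_two {n : ℕ} (F : Fin n × Fin n → ℝ) :
    ∑ S : Fin 2 ↪o Fin n, F (S 0, S 1) = ∑ p : Fin n × Fin n with p.1 < p.2, F p := by
  classical
  refine Finset.sum_bij (fun S _ => (S 0, S 1)) (fun S _ => ?_) (fun S _ T _ h => ?_)
    (fun p hp => ?_) (fun _ _ => rfl)
  · simp
  · ext i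
    simp only [Prod.mk.injEq] at h
    fin_cases i
    · simp [h.1]
    · simp [h.2]
  · have hlt : p.1 < p.2 := (Finset.mem_filter.1 hp).2
    refine ⟨OrderEmbedding.ofStrictMono ![p.1, p.2] ?_, Finset.mem_univ _, ?_⟩
    · intro i j hij
      fin_cases i <;> fin_cases j <;> simp_all
    · rfl

theorem wedgeNorm_pair_sq {n : ℕ} (X Y : E n) :
    wedgeNorm ![X, Y] ^ 2 = ‖X‖ ^ 2 * ‖Y‖ ^ 2 - inner ℝ X Y ^ 2 := by
  set F : Fin n × Fin n → ℝ := fun p => (X p.1 * Y p.2 - X p.2 * Y p.1) ^ 2 with hF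
  have h1 : wedgeNorm ![X, Y] ^ 2 = ∑ S : Fin 2 ↪o Fin n, F (S 0, S 1) := by
    unfold wedgeNorm
    rw [Real.sq_sqrt (Finset.sum_nonneg fun _ _ => sq_nonneg _)]
    refine Finset.sum_congr rfl fun S _ => ?_
    simp [plucker, Matrix.det_fin_two, hF]
  -- This is Lagrange's identity: `F` is symmetric and vanishes on the diagonal, so the full double
  -- sum counts each pair twice.
  have h2 : ∑ p, F p = 2 * ∑ p : Fin n × Fin n with p.1 < p.2, F p := by
    have hsplit : ∀ p, F p = (if p.1 < p.2 then F p else 0) + (if p.2 < p.1 then F p else 0) := by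
      intro p
      rcases lt_trichotomy p.1 p.2 with h | h | h
      · simp [h, h.le]
      · simp [hF, h]
      · simp [h, h.le]
    have hswap : ∑ p : Fin n × Fin n, (if p.2 < p.1 then F p else 0)
        = ∑ p : Fin n × Fin n, (if p.1 < p.2 then F p else 0) := by
      refine Fintype.sum_equiv (Equiv.prodComm _ _) _ _ fun p => ?_
      simp only [Equiv.prodComm_apply, Prod.fst_swap, Prod.snd_swap, hF]
      split_ifs
      · ring
      · rfl
    rw [Finset.sum_congr rfl fun p _ => hsplit p, Finset.sum_add_distrib, hswap,
      Finset.sum_filter]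
    ring
  have h3 : ∑ p, F p = 2 * (‖X‖ ^ 2 * ‖Y‖ ^ 2 - inner ℝ X Y ^ 2) := by
    have hin : (inner ℝ X Y : ℝ) = ∑ i, X i * Y i := by
      simp [PiLp.inner_apply, mul_comm]
    rw [EuclideanSpace.norm_sq_eq, EuclideanSpace.norm_sq_eq, hin, Fintype.sum_prod_type]
    simp only [hF, Real.norm_eq_abs, sq_abs]
    have : ∀ i j, (X i * Y j - X j * Y i) ^ 2
        = X i ^ 2 * Y j ^ 2 + X j ^ 2 * Y i ^ 2 - 2 * ((X i * Y i) * (X j * Y j)) := by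
      intros; ring
    simp only [this, Finset.sum_sub_distrib, Finset.sum_add_distrib, ← Finset.mul_sum,
      ← Finset.sum_mul]
    ring
  rw [h1, sum_orderEmb_fin_two]
  linarith

theorem wedgeNorm_nonneg {n m : ℕ} (v : Fin m → E n) : 0 ≤ wedgeNorm v :=
  Real.sqrt_nonneg _

theorem omega_nonneg {n : ℕ} (X Y : E n) : 0 ≤ omega X Y :=
  div_nonneg (wedgeNorm_nonneg _) (by positivity)

theorem omega_sq_mul {n : ℕ} {X Y : E n} (hX : X ≠ 0) (hY : Y ≠ 0) :
    omega X Y ^ 2 * (‖X‖ ^ 2 * ‖Y‖ ^ 2) = ‖X‖ ^ 2 * ‖Y‖ ^ 2 - inner ℝ X Y ^ 2 := by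
  have := norm_pos_iff.2 hX
  have := norm_pos_iff.2 hY
  rw [omega, div_pow, wedgeNorm_pair_sq]
  field_simp

theorem omega_le_one {n : ℕ} {X Y : E n} (hX : X ≠ 0) (hY : Y ≠ 0) : omega X Y ≤ 1 := by
  have h1 := norm_pos_iff.2 hX
  have h2 := norm_pos_iff.2 hY
  have h := omega_sq_mul hX hY
  have h3 : omega X Y ^ 2 ≤ 1 := by
    by_contra! hc
    have : (0:ℝ) < ‖X‖ ^ 2 * ‖Y‖ ^ 2 := by positivity
    nlinarith [sq_nonneg (inner ℝ X Y : ℝ)]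
  exact (sq_le_one_iff₀ (omega_nonneg _ _)).1 h3

/-- The distance from `X` to the line through `Y` is `ω(X, Y) ‖X‖`. -/
theorem norm_sub_smul_eq {n : ℕ} {X Y : E n} (hX : X ≠ 0) (hY : Y ≠ 0) :
    ‖X - (inner ℝ X Y / ‖Y‖ ^ 2) • Y‖ = omega X Y * ‖X‖ := by
  have h1 := norm_pos_iff.2 hX
  have h2 := norm_pos_iff.2 hY
  rw [← sq_eq_sq₀ (norm_nonneg _) (mul_nonneg (omega_nonneg _ _) h1.le), norm_sub_sq_real,
    inner_smul_right, norm_smul, mul_pow, mul_pow, Real.norm_eq_abs, sq_abs]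
  have h := omega_sq_mul hX hY
  have h4 : omega X Y ^ 2 * ‖X‖ ^ 2 = ‖X‖ ^ 2 - inner ℝ X Y ^ 2 / ‖Y‖ ^ 2 := by
    field_simp
    linarith
  rw [h4]
  field_simp
  ring

theorem omega_mul_norm_le {n : ℕ} {X Y : E n} (hX : X ≠ 0) (hY : Y ≠ 0) :
    omega X Y * ‖X‖ ≤ ‖X - Y‖ := by
  have h2 := norm_pos_iff.2 hY
  rw [← norm_sub_smul_eq hX hY, ← sq_le_sq₀ (norm_nonneg _) (norm_nonneg _), norm_sub_sq_real,
    norm_sub_sq_real, inner_smul_right, norm_smul, mul_pow, Real.norm_eq_abs, sq_abs]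
  have h3 : (0 : ℝ) ≤ (inner ℝ X Y / ‖Y‖ ^ 2 - 1) ^ 2 * ‖Y‖ ^ 2 := by positivity
  have h4 : (inner ℝ X Y : ℝ) = inner ℝ X Y / ‖Y‖ ^ 2 * ‖Y‖ ^ 2 := by field_simp
  nlinarith

theorem minPair_spec {n : ℕ} {A B : Submodule ℝ (E n)} (hA : A ≠ ⊥) (hB : B ≠ ⊥) :
    IsMinPair A B (minPair A B) :=
  Classical.epsilon_spec (exists_isMinPair hA hB)

/-- First order condition for a pair that realizes the minimum of `ω`. -/
theorem IsMinPair.inner_eq_zero {n : ℕ} {A B : Submodule ℝ (E n)} {p : E n × E n}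
    (hp : IsMinPair A B p) {x : E n} (hx : x ∈ A) (hxp : inner ℝ p.1 x = 0) :
    inner ℝ x p.2 = 0 := by
  obtain ⟨X, Y⟩ := p
  obtain ⟨⟨hXA, hX0⟩, ⟨hYB, hY0⟩, hmin⟩ := hp
  simp only at hXA hX0 hYB hY0 hmin hxp ⊢
  by_cases hx0 : x = 0
  · simp [hx0]
  have h1 := norm_pos_iff.2 hX0
  have h2 := norm_pos_iff.2 hY0
  have h3 := norm_pos_iff.2 hx0
  set c : ℝ := inner ℝ X Y
  set s : ℝ := inner ℝ x Y
  by_contra hs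
  -- Up to a positive factor, `Z` is the projection of `Y` onto the plane spanned by `X` and `x`. It
  -- makes a strictly smaller angle with `Y` than `X` does as soon as `s ≠ 0`.
  set Z : E n := (c * ‖x‖ ^ 2) • X + (s * ‖X‖ ^ 2) • x with hZ
  have hZY : inner ℝ Z Y = c ^ 2 * ‖x‖ ^ 2 + s ^ 2 * ‖X‖ ^ 2 := by
    rw [hZ, inner_add_left, inner_smul_left, inner_smul_left]
    simp only [conj_trivial]
    ring
  have hZZ : ‖Z‖ ^ 2 = ‖x‖ ^ 2 * ‖X‖ ^ 2 * (c ^ 2 * ‖x‖ ^ 2 + s ^ 2 * ‖X‖ ^ 2) := by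
    rw [hZ, norm_add_sq_real, inner_smul_left, inner_smul_right, hxp, norm_smul, norm_smul,
      mul_pow, mul_pow, Real.norm_eq_abs, Real.norm_eq_abs, sq_abs, sq_abs]
    ring
  have hpos : 0 < c ^ 2 * ‖x‖ ^ 2 + s ^ 2 * ‖X‖ ^ 2 := by positivity
  have hZ0 : Z ≠ 0 := by
    intro h
    have : 0 < ‖x‖ ^ 2 * ‖X‖ ^ 2 * (c ^ 2 * ‖x‖ ^ 2 + s ^ 2 * ‖X‖ ^ 2) := by positivity
    rw [← hZZ, h, norm_zero, zero_pow two_ne_zero] at this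
    exact this.false
  have hle := hmin Z (A.add_mem (A.smul_mem _ hXA) (A.smul_mem _ hx)) hZ0 Y hYB hY0
  have hle2 : omega X Y ^ 2 ≤ omega Z Y ^ 2 := pow_le_pow_left₀ (omega_nonneg _ _) hle 2
  have e1 := omega_sq_mul hX0 hY0
  have e2 := omega_sq_mul hZ0 hY0
  rw [hZY, hZZ] at e2
  set Q := c ^ 2 * ‖x‖ ^ 2 + s ^ 2 * ‖X‖ ^ 2 with hQ
  have e2' : omega Z Y ^ 2 * (‖x‖ ^ 2 * ‖X‖ ^ 2 * ‖Y‖ ^ 2) = ‖x‖ ^ 2 * ‖X‖ ^ 2 * ‖Y‖ ^ 2 - Q := by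
    have : Q * (omega Z Y ^ 2 * (‖x‖ ^ 2 * ‖X‖ ^ 2 * ‖Y‖ ^ 2)) =
      Q * (‖x‖ ^ 2 * ‖X‖ ^ 2 * ‖Y‖ ^ 2 - Q) := by linarith
    exact mul_left_cancel₀ hpos.ne' this
  have e1' : omega X Y ^ 2 * (‖x‖ ^ 2 * ‖X‖ ^ 2 * ‖Y‖ ^ 2)
      = ‖x‖ ^ 2 * ‖X‖ ^ 2 * ‖Y‖ ^ 2 - c ^ 2 * ‖x‖ ^ 2 := by
    linear_combination ‖x‖ ^ 2 * e1
  have hk : 0 ≤ ‖x‖ ^ 2 * ‖X‖ ^ 2 * ‖Y‖ ^ 2 := by positivity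
  have := mul_le_mul_of_nonneg_right hle2 hk
  have hsX : 0 < s ^ 2 * ‖X‖ ^ 2 := by positivity
  linarith

/-! ### The successive angles -/

theorem finrank_le_inf_orthogonal {n : ℕ} (V : Submodule ℝ (E n)) (X : E n) :
    finrank ℝ V ≤ finrank ℝ ↥(V ⊓ (ℝ ∙ X)ᗮ) + 1 := by
  have h1 := Submodule.finrank_sup_add_finrank_inf_eq V (ℝ ∙ X)ᗮ
  have h2 := Submodule.finrank_add_finrank_orthogonal (ℝ ∙ X)
  have h3 := finrank_span_le_card (R := ℝ) ({X} : Set (E n))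
  have h4 := Submodule.finrank_le (V ⊔ (ℝ ∙ X)ᗮ)
  simp at h3
  omega

theorem ne_bot_of_finrank_pos {n : ℕ} {V : Submodule ℝ (E n)} (h : 0 < finrank ℝ V) : V ≠ ⊥ := by
  rintro rfl
  simp at h

theorem angle_nonneg {n : ℕ} : ∀ (l : ℕ) (A B : Submodule ℝ (E n)), 0 ≤ angle l A B
  | 0, _, _ => le_rfl
  | 1, _, _ => omega_nonneg _ _
  | l + 2, _, _ => angle_nonneg (l + 1) _ _

/-- Passing to the orthogonal complements shrinks both subspaces, so the successive minima can only
grow. -/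
theorem omega_minPair_le_angle {n : ℕ} : ∀ (l : ℕ) (A B : Submodule ℝ (E n)),
    l + 1 ≤ finrank ℝ A → l + 1 ≤ finrank ℝ B →
    omega (minPair A B).1 (minPair A B).2 ≤ angle (l + 1) A B
  | 0, _, _, _, _ => le_rfl
  | l + 1, A, B, hA, hB => by
    have hA1 := finrank_le_inf_orthogonal A (minPair A B).1
    have hB1 := finrank_le_inf_orthogonal B (minPair A B).2
    refine le_trans ?_ (omega_minPair_le_angle l _ _ (by omega) (by omega))
    have hp := minPair_spec (A := A) (B := B) (ne_bot_of_finrank_pos (by omega))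
      (ne_bot_of_finrank_pos (by omega))
    have hq := minPair_spec (A := A ⊓ (ℝ ∙ (minPair A B).1)ᗮ) (B := B ⊓ (ℝ ∙ (minPair A B).2)ᗮ)
      (ne_bot_of_finrank_pos (by omega)) (ne_bot_of_finrank_pos (by omega))
    exact hp.2.2 _ hq.1.1.1 hq.1.2 _ hq.2.1.1.1 hq.2.1.2

/-- A subspace whose vectors are close to `B`, given by the angles. -/
theorem exists_le_of_angle {n : ℕ} : ∀ (l : ℕ) (A B : Submodule ℝ (E n)),
    l ≤ finrank ℝ A → l ≤ finrank ℝ B →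
    ∃ V ≤ A, finrank ℝ V = l ∧
      ∀ x ∈ V, ∃ y ∈ B, ‖x - y‖ ≤ l * angle l A B * ‖x‖
  | 0, A, B, _, _ => by
    refine ⟨⊥, bot_le, by simp, fun x hx => ⟨0, B.zero_mem, ?_⟩⟩
    simp [(Submodule.mem_bot ℝ).1 hx]
  | l + 1, A, B, hA, hB => by
    have hp := minPair_spec (A := A) (B := B) (ne_bot_of_finrank_pos (by omega))
      (ne_bot_of_finrank_pos (by omega))
    have hω := omega_minPair_le_angle l A B hA hB
    have hA1 := finrank_le_inf_orthogonal A (minPair A B).1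
    have hB1 := finrank_le_inf_orthogonal B (minPair A B).2
    obtain ⟨V, hVA, hVl, hV⟩ := exists_le_of_angle l (A ⊓ (ℝ ∙ (minPair A B).1)ᗮ)
      (B ⊓ (ℝ ∙ (minPair A B).2)ᗮ) (by omega) (by omega)
    -- For `l = 0` the two angles differ, but the factor `l` kills both sides.
    have hang : l * angle l (A ⊓ (ℝ ∙ (minPair A B).1)ᗮ) (B ⊓ (ℝ ∙ (minPair A B).2)ᗮ)
        = l * angle (l + 1) A B := by
      cases l with
      | zero => simp
      | succ l => rfl
    rw [hang] at hV
    set X := (minPair A B).1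
    set Y := (minPair A B).2
    obtain ⟨⟨hXA, hX0⟩, ⟨hYB, hY0⟩, -⟩ := hp
    have hXV : ∀ v ∈ V, inner ℝ X v = 0 := fun v hv =>
      Submodule.mem_orthogonal_singleton_iff_inner_right.1 (hVA hv).2
    have hdisj : Disjoint (ℝ ∙ X) V := by
      rw [Submodule.disjoint_def]
      intro v hv hv'
      obtain ⟨a, rfl⟩ := Submodule.mem_span_singleton.1 hv
      have := hXV _ hv'
      rw [inner_smul_right] at this
      rcases mul_eq_zero.1 this with h | h
      · simp [h]
      · exact absurd (inner_self_eq_zero.1 h) hX0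
    refine ⟨(ℝ ∙ X) ⊔ V, sup_le ?_ (hVA.trans inf_le_left), ?_, ?_⟩
    · rwa [Submodule.span_singleton_le_iff_mem]
    · have := Submodule.finrank_sup_add_finrank_inf_eq (ℝ ∙ X) V
      rw [hdisj.eq_bot, finrank_bot, finrank_span_singleton hX0] at this
      omega
    · intro x hx
      obtain ⟨z, hz, v, hv, rfl⟩ := Submodule.mem_sup.1 hx
      obtain ⟨a, rfl⟩ := Submodule.mem_span_singleton.1 hz
      obtain ⟨y, hy, hvy⟩ := hV v hv
      have horth : inner ℝ (a • X) v = 0 := by rw [inner_smul_left, hXV v hv, mul_zero]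
      have hpyth := norm_add_sq_eq_norm_sq_add_norm_sq_of_inner_eq_zero _ _ horth
      have hle1 : ‖a • X‖ ≤ ‖a • X + v‖ := by
        nlinarith [norm_nonneg (a • X + v), norm_nonneg (a • X), mul_self_nonneg ‖v‖]
      have hle2 : ‖v‖ ≤ ‖a • X + v‖ := by
        nlinarith [norm_nonneg (a • X + v), norm_nonneg v, mul_self_nonneg ‖a • X‖]
      refine ⟨a • (inner ℝ X Y / ‖Y‖ ^ 2) • Y + y,
        B.add_mem (B.smul_mem _ (B.smul_mem _ hYB)) hy.1, ?_⟩
      have h1 : ‖a • X - a • (inner ℝ X Y / ‖Y‖ ^ 2) • Y‖ = omega X Y * ‖a • X‖ := by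
        rw [← smul_sub, norm_smul, norm_sub_smul_eq hX0 hY0, norm_smul]
        ring
      have h2 : a • X + v - (a • (inner ℝ X Y / ‖Y‖ ^ 2) • Y + y)
          = (a • X - a • (inner ℝ X Y / ‖Y‖ ^ 2) • Y) + (v - y) := by abel
      have hang0 := angle_nonneg (l + 1) A B
      rw [h2]
      refine (norm_add_le _ _).trans ?_
      rw [h1]
      have h3 : omega X Y * ‖a • X‖ ≤ angle (l + 1) A B * ‖a • X + v‖ :=
        mul_le_mul hω hle1 (norm_nonneg _) hang0
      have h4 : l * angle (l + 1) A B * ‖v‖ ≤ l * angle (l + 1) A B * ‖a • X + v‖ :=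
        mul_le_mul_of_nonneg_left hle2 (by positivity)
      push_cast
      linarith

/-- A converse of `exists_le_of_angle`. The property of `V` survives in `V ∩ X₁ᗮ` relative to `B ∩
Y₁ᗮ`, which loses at most one dimension, so no constant accumulates in the induction. -/
theorem angle_le_of_forall {n : ℕ} {ε : ℝ} : ∀ (l : ℕ) (A B V : Submodule ℝ (E n)),
    V ≤ A → l + 1 ≤ finrank ℝ V → l + 1 ≤ finrank ℝ B →
    (∀ x ∈ V, ∃ y ∈ B, ‖x - y‖ ≤ ε * ‖x‖) → angle (l + 1) A B ≤ ε
  | 0, A, B, V, hVA, hV, hB, h => by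
    have hV0 := ne_bot_of_finrank_pos (V := V) (by omega)
    have hB0 := ne_bot_of_finrank_pos (V := B) (by omega)
    have hp := minPair_spec (ne_bot_of_le_ne_bot hV0 hVA) hB0
    obtain ⟨x, hx, hx0⟩ := Submodule.exists_mem_ne_zero_of_ne_bot hV0
    obtain ⟨y, hy, hxy⟩ := h x hx
    have hx1 := norm_pos_iff.2 hx0
    change omega _ _ ≤ ε
    -- If the approximating vector is `0`, then `ε ≥ 1`, which bounds every `ω`.
    by_cases hy0 : y = 0
    · obtain ⟨z, hz, hz0⟩ := Submodule.exists_mem_ne_zero_of_ne_bot hB0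
      refine (hp.2.2 x (hVA hx) hx0 z hz hz0).trans ((omega_le_one hx0 hz0).trans ?_)
      rw [hy0, sub_zero] at hxy
      nlinarith
    · refine (hp.2.2 x (hVA hx) hx0 y hy hy0).trans ?_
      exact le_of_mul_le_mul_right ((omega_mul_norm_le hx0 hy0).trans hxy) hx1
  | l + 1, A, B, V, hVA, hV, hB, h => by
    have hV0 := ne_bot_of_finrank_pos (V := V) (by omega)
    have hB0 := ne_bot_of_finrank_pos (V := B) (by omega)
    have hp := minPair_spec (ne_bot_of_le_ne_bot hV0 hVA) hB0
    have hV1 := finrank_le_inf_orthogonal V (minPair A B).1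
    have hB1 := finrank_le_inf_orthogonal B (minPair A B).2
    change angle (l + 1) (A ⊓ (ℝ ∙ (minPair A B).1)ᗮ) (B ⊓ (ℝ ∙ (minPair A B).2)ᗮ) ≤ ε
    refine angle_le_of_forall l _ _ (V ⊓ (ℝ ∙ (minPair A B).1)ᗮ) (inf_le_inf_right _ hVA)
      (by omega) (by omega) fun x hx => ?_
    obtain ⟨y, hy, hxy⟩ := h x hx.1
    have hxY := hp.inner_eq_zero (hVA hx.1)
      (Submodule.mem_orthogonal_singleton_iff_inner_right.1 hx.2)
    set Y := (minPair A B).2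
    have hY1 : 0 < ‖Y‖ := norm_pos_iff.2 hp.2.1.2
    set t : ℝ := inner ℝ y Y / ‖Y‖ ^ 2
    have htY : inner ℝ (y - t • Y) Y = 0 := by
      rw [inner_sub_left, inner_smul_left, real_inner_self_eq_norm_sq, conj_trivial]
      simp only [t]
      field_simp
      ring
    -- By the first order condition `x` is orthogonal to `Y`, so removing from `y` its component
    -- along `Y` can only bring it closer to `x`.
    refine ⟨y - t • Y, ⟨B.sub_mem hy (B.smul_mem _ hp.2.1.1),
      Submodule.mem_orthogonal_singleton_iff_inner_left.2 htY⟩, le_trans ?_ hxy⟩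
    have horth : inner ℝ (x - (y - t • Y)) (-(t • Y)) = 0 := by
      rw [inner_neg_right, inner_smul_right, inner_sub_left, hxY, htY]
      simp
    have hpyth := norm_add_sq_eq_norm_sq_add_norm_sq_of_inner_eq_zero _ _ horth
    have heq : x - (y - t • Y) + -(t • Y) = x - y := by abel
    rw [heq] at hpyth
    nlinarith [norm_nonneg (x - y), norm_nonneg (x - (y - t • Y)), mul_self_nonneg ‖-(t • Y)‖]

/-! ### Plücker coordinates -/

theorem plucker_sum_smul {n m : ℕ} (W : Matrix (Fin m) (Fin m) ℝ) (v : Fin m → E n)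
    (S : Fin m ↪o Fin n) :
    plucker (fun i => ∑ j, W i j • v j) S = W.det * plucker v S := by
  unfold plucker
  rw [← Matrix.det_mul]
  congr 1
  ext i j
  simp [Matrix.mul_apply]

theorem plucker_eq_zero_of_not_linearIndependent {n m : ℕ} {v : Fin m → E n}
    (hv : ¬ LinearIndependent ℝ v) (S : Fin m ↪o Fin n) : plucker v S = 0 := by
  rw [Fintype.not_linearIndependent_iff] at hv
  obtain ⟨c, hc, i, hi⟩ := hv
  refine Matrix.exists_vecMul_eq_zero_iff.1 ⟨c, fun h => hi (congrFun h i), ?_⟩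
  ext j
  have := congrArg (fun x : E n => x (S j)) hc
  simpa [Matrix.vecMul, dotProduct] using this

theorem plucker_cons {n m : ℕ} (x : E n) (v : Fin m → E n) (S : Fin (m + 1) ↪o Fin n) :
    plucker (Fin.cons x v) S =
      ∑ j : Fin (m + 1), (-1) ^ (j : ℕ) * x (S j) * plucker v ((Fin.succAboveOrderEmb j).trans S) := by
  unfold plucker
  rw [Matrix.det_succ_row_zero]
  rfl

theorem mem_span_iff_plucker_cons_eq_zero {n m : ℕ} {v : Fin m → E n} {x : E n}
    (hv : LinearIndependent ℝ v) :
    x ∈ Submodule.span ℝ (Set.range v) ↔ ∀ S, plucker (Fin.cons x v : Fin (m + 1) → E n) S = 0 := by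
  constructor
  · intro hx S
    refine plucker_eq_zero_of_not_linearIndependent (fun h => ?_) S
    exact (linearIndependent_finCons.1 h).2 hx
  · intro h
    by_contra hx
    obtain ⟨S, hS⟩ := exists_plucker_ne_zero (linearIndependent_finCons.2 ⟨hv, hx⟩)
    exact hS (h S)

/-- Plücker coordinates determine the subspace. -/
theorem span_eq_of_plucker_eq {n m : ℕ} {v w : Fin m → E n} (hv : LinearIndependent ℝ v)
    (hw : LinearIndependent ℝ w) {a b : ℝ} (ha : a ≠ 0) (hb : b ≠ 0)
    (h : ∀ S, a * plucker v S = b * plucker w S) :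
    Submodule.span ℝ (Set.range v) = Submodule.span ℝ (Set.range w) := by
  ext x
  rw [mem_span_iff_plucker_cons_eq_zero hv, mem_span_iff_plucker_cons_eq_zero hw]
  -- Laplace expansion along the row `x` involves `v` only through its own Plücker coordinates, so
  -- the proportionality extends to the minors that test membership of `x`.
  have key : ∀ S, a * plucker (Fin.cons x v : Fin (m + 1) → E n) S
      = b * plucker (Fin.cons x w : Fin (m + 1) → E n) S := by
    intro S
    rw [plucker_cons, plucker_cons, Finset.mul_sum, Finset.mul_sum]
    refine Finset.sum_congr rfl fun j _ => ?_
    rw [mul_left_comm, h, mul_left_comm]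
  refine forall_congr' fun S => ?_
  rw [← mul_right_inj' ha, key, mul_zero, mul_eq_zero, or_iff_right hb]

/-- A repeated index makes the minor vanish; otherwise sorting the indices costs a sign. The
coefficients therefore do not depend on `v`. -/
theorem exists_det_eq_sum_plucker {n m : ℕ} (f : Fin m → Fin n) :
    ∃ a : (Fin m ↪o Fin n) → ℤ, ∀ v : Fin m → E n,
      (Matrix.of fun i j => v j (f i)).det = ∑ S, a S * plucker v S := by
  classical
  by_cases hf : Function.Injective f
  · set T : Finset (Fin n) := Finset.univ.image f with hT
    have hTcard : T.card = m := by
      rw [hT, Finset.card_image_of_injective _ hf, Finset.card_univ, Fintype.card_fin]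
    have hmem : ∀ i : Fin m, ∃ k, T.orderEmbOfFin hTcard k = f i := fun i => by
      have : f i ∈ Set.range (T.orderEmbOfFin hTcard) := by
        rw [Finset.range_orderEmbOfFin]
        simp [hT]
      exact this
    choose σ hσ using hmem
    have hσinj : Function.Injective σ := fun i j hij => hf (by rw [← hσ, ← hσ, hij])
    set τ : Equiv.Perm (Fin m) := Equiv.ofBijective σ (Finite.injective_iff_bijective.1 hσinj)
    refine ⟨Pi.single (T.orderEmbOfFin hTcard) (Equiv.Perm.sign τ : ℤ), fun v => ?_⟩
    rw [Finset.sum_eq_single (T.orderEmbOfFin hTcard)]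
    · have h := Matrix.det_permute τ
        (Matrix.of fun i j => v j (T.orderEmbOfFin hTcard i) : Matrix (Fin m) (Fin m) ℝ)
      have h2 : (Matrix.of fun i j => v j (T.orderEmbOfFin hTcard i) :
          Matrix (Fin m) (Fin m) ℝ).submatrix τ id = Matrix.of fun i j => v j (f i) := by
        ext i j
        simp [τ, hσ]
      rw [← h2, h, Pi.single_eq_same]
      congr 1
      unfold plucker
      rw [← Matrix.det_transpose]
      rfl
    · intro S _ hS
      simp [Pi.single_eq_of_ne hS]
    · simp
  · refine ⟨0, fun v => ?_⟩
    obtain ⟨i, j, hij, hne⟩ := Function.not_injective_iff.1 hf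
    rw [Matrix.det_zero_of_row_eq hne (by ext k; simp [hij])]
    simp

/-- The linear map of `ℝⁿ` given by a matrix of integers. -/
noncomputable def intLin {n : ℕ} (M : Matrix (Fin n) (Fin n) ℤ) : E n →ₗ[ℝ] E n :=
  Matrix.toEuclideanLin (M.map (Int.cast : ℤ → ℝ))

theorem intLin_apply {n : ℕ} (M : Matrix (Fin n) (Fin n) ℤ) (x : E n) (i : Fin n) :
    intLin M x i = ∑ j, (M i j : ℝ) * x j := by
  simp [intLin, Matrix.toEuclideanLin, Matrix.mulVec, dotProduct]

/-- The induced map on exterior powers has an integer matrix: expand the determinant multilinearly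
in the rows, as in the Cauchy–Binet formula. -/
theorem exists_plucker_intLin {n : ℕ} (m : ℕ) (M : Matrix (Fin n) (Fin n) ℤ) :
    ∃ a : (Fin m ↪o Fin n) → (Fin m ↪o Fin n) → ℤ, ∀ (v : Fin m → E n) (S : Fin m ↪o Fin n),
      plucker (fun i => intLin M (v i)) S = ∑ T, a S T * plucker v T := by
  choose a ha using fun f : Fin m → Fin n => exists_det_eq_sum_plucker f
  refine ⟨fun S T => ∑ f : Fin m → Fin n, (∏ i, M (S i) (f i)) * a f T, fun v S => ?_⟩
  have h1 : plucker (fun i => intLin M (v i)) S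
      = Matrix.detRowAlternating (R := ℝ) (n := Fin m)
        (fun j => ∑ k, (M (S j) k : ℝ) • fun i => v i k) := by
    unfold plucker
    rw [← Matrix.det_transpose]
    change Matrix.det _ = Matrix.det _
    congr 1
    ext i j
    simp [intLin_apply]
  rw [h1]
  have h2 := MultilinearMap.map_sum (Matrix.detRowAlternating (R := ℝ) (n := Fin m)).toMultilinearMap
    (fun j k => (M (S j) k : ℝ) • fun i => v i k)
  refine h2.trans ?_
  have h3 : ∀ f : Fin m → Fin n,
      (Matrix.detRowAlternating (R := ℝ) (n := Fin m)).toMultilinearMap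
        (fun j => (M (S j) (f j) : ℝ) • fun i => v i (f j))
      = ∑ T, (∏ i, (M (S i) (f i) : ℝ)) * (a f T * plucker v T) := by
    intro f
    rw [MultilinearMap.map_smul_univ, ← Finset.mul_sum, ← ha f v]
    rfl
  rw [Finset.sum_congr rfl fun f _ => h3 f, Finset.sum_comm]
  refine Finset.sum_congr rfl fun T _ => ?_
  push_cast
  rw [Finset.sum_mul]
  exact Finset.sum_congr rfl fun f _ => by ring

/-! ### Heights -/

theorem isRational_of_span_eq {n m : ℕ} {B : Submodule ℝ (E n)} {v : Fin m → E n}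
    (hv : LinearIndependent ℝ v) (hB : Submodule.span ℝ (Set.range v) = B)
    (hq : ∀ i j, ∃ q : ℚ, v i j = q) : IsRational B := by
  have hm : m = finrank ℝ B := by rw [← hB, finrank_span_eq_card hv, Fintype.card_fin]
  subst hm
  refine ⟨(Basis.span hv).map (LinearEquiv.ofEq _ _ hB), fun i j => ?_⟩
  simpa [Basis.span_apply] using hq i j

theorem IsRational.exists_span_eq {n m : ℕ} {B : Submodule ℝ (E n)} (hB : IsRational B)
    (hm : finrank ℝ B = m) : ∃ v : Fin m → E n, LinearIndependent ℝ v ∧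
      Submodule.span ℝ (Set.range v) = B ∧ ∀ i j, ∃ q : ℚ, v i j = q := by
  subst hm
  obtain ⟨b, hb⟩ := hB
  refine ⟨fun i => b i, b.linearIndependent.map' B.subtype (by simp), ?_, hb⟩
  have := congrArg (Submodule.map B.subtype) b.span_eq
  rw [Submodule.map_span, ← Set.range_comp, Submodule.map_top, Submodule.range_subtype] at this
  exact this

theorem exists_height_eq {n m : ℕ} {B : Submodule ℝ (E n)} (hB : IsRational B)
    (hm : finrank ℝ B = m) : ∃ (v : Fin m → E n) (z : (Fin m ↪o Fin n) → ℤ) (c : ℝ),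
      LinearIndependent ℝ v ∧ Submodule.span ℝ (Set.range v) = B ∧ c ≠ 0 ∧
      (∀ S, (z S : ℝ) = c * plucker v S) ∧ height B = √(∑ S, (z S : ℝ) ^ 2) := by
  subst hm
  obtain ⟨-, b, c, hc, hη⟩ := Classical.epsilon_spec (exists_isPrimitivePlucker hB)
  refine ⟨fun i => b i, _, c, b.linearIndependent.map' B.subtype (by simp), ?_, hc, hη, rfl⟩
  have := congrArg (Submodule.map B.subtype) b.span_eq
  rw [Submodule.map_span, ← Set.range_comp, Submodule.map_top, Submodule.range_subtype] at this
  exact this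

/-- By Bézout, an integer vector proportional to a primitive one is an integer multiple of it, and
the multiple is nonzero because `v` is independent. -/
theorem height_le {n m : ℕ} {B : Submodule ℝ (E n)} (hB : IsRational B)
    (hm : finrank ℝ B = m) {v : Fin m → E n} (hv : LinearIndependent ℝ v) (hvB : ∀ i, v i ∈ B)
    {z : (Fin m ↪o Fin n) → ℤ} {c : ℝ} (hc : c ≠ 0) (hz : ∀ S, (z S : ℝ) = c * plucker v S) :
    height B ≤ √(∑ S, (z S : ℝ) ^ 2) := by
  subst hm
  obtain ⟨hgcd, b, c', hc', hη⟩ := Classical.epsilon_spec (exists_isPrimitivePlucker hB)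
  unfold height
  set η := Classical.epsilon (IsPrimitivePlucker B)
  set W : Matrix (Fin (finrank ℝ B)) (Fin (finrank ℝ B)) ℝ :=
    Matrix.of fun i j => b.repr ⟨v i, hvB i⟩ j
  have hvW : v = fun i => ∑ j, W i j • (b j : E n) := by
    funext i
    have := congrArg (B.subtype) (b.sum_repr ⟨v i, hvB i⟩)
    rw [map_sum] at this
    simpa [W] using this.symm
  have hzη : ∀ S, (z S : ℝ) = c * W.det / c' * η S := by
    intro S
    rw [hz, hη, hvW, plucker_sum_smul]
    field_simp
  obtain ⟨f, hf⟩ := Finset.gcd_eq_sum_mul Finset.univ η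
  rw [hgcd] at hf
  set N : ℤ := ∑ S, z S * f S
  have hN : c * W.det / c' = (N : ℝ) := by
    have hf' : (1 : ℝ) = ∑ S, (η S : ℝ) * f S := by exact_mod_cast hf
    calc c * W.det / c' = c * W.det / c' * ∑ S, (η S : ℝ) * f S := by rw [← hf', mul_one]
      _ = ∑ S, (z S : ℝ) * f S := by
        rw [Finset.mul_sum]
        exact Finset.sum_congr rfl fun S _ => by rw [hzη]; ring
      _ = (N : ℝ) := by simp [N]
  have hN0 : N ≠ 0 := by
    intro h
    obtain ⟨S, hS⟩ := exists_plucker_ne_zero hv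
    have h1 := hz S
    rw [hzη, hN, h] at h1
    simp [hc, hS] at h1
  refine Real.sqrt_le_sqrt (Finset.sum_le_sum fun S _ => ?_)
  rw [hzη, hN, mul_pow]
  have : (1 : ℝ) ≤ (N : ℝ) ^ 2 := by
    have : (1 : ℤ) ≤ N ^ 2 := by
      have := sq_nonneg N
      have := pow_ne_zero 2 hN0
      omega
    exact_mod_cast this
  nlinarith [sq_nonneg (η S : ℝ)]

theorem one_le_height {n : ℕ} {B : Submodule ℝ (E n)} (hB : IsRational B) : 1 ≤ height B := by
  obtain ⟨v, z, c, hv, -, hc, hz, hh⟩ := exists_height_eq hB rfl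
  obtain ⟨S, hS⟩ := exists_plucker_ne_zero hv
  have hzS : z S ≠ 0 := by
    intro h
    have := hz S
    rw [h] at this
    simp [hc, hS] at this
  rw [hh, Real.one_le_sqrt]
  refine le_trans ?_ (Finset.single_le_sum (fun S _ => sq_nonneg (z S : ℝ)) (Finset.mem_univ S))
  have : (1 : ℤ) ≤ z S ^ 2 := by
    have := sq_nonneg (z S)
    have := pow_ne_zero 2 hzS
    omega
  exact_mod_cast this

/-- Northcott's property: a subspace is determined by its integer Plücker vector, and only finitely
many integer vectors have bounded norm. -/
theorem finite_height_le (n e : ℕ) (T : ℝ) :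
    {B ∈ RationalSubspaces n e | height B ≤ T}.Finite := by
  classical
  set I := {B ∈ RationalSubspaces n e | height B ≤ T}
  choose v z c hv hspan hc hz hh using fun B : I => exists_height_eq B.2.1.1 B.2.1.2
  have hinj : Function.Injective z := by
    intro B B' h
    apply Subtype.ext
    rw [← hspan B, ← hspan B']
    refine span_eq_of_plucker_eq (hv B) (hv B') (hc B) (hc B') fun S => ?_
    rw [← hz, ← hz, h]
  have hfin : (Set.range z).Finite := by
    refine (Set.Finite.pi' (t := fun _ : Fin e ↪o Fin n => Set.Icc (-⌈T⌉) ⌈T⌉)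
      fun _ => Set.finite_Icc _ _).subset ?_
    rintro _ ⟨B, rfl⟩ S
    have h1 : |(z B S : ℝ)| ≤ T := by
      refine le_trans ?_ B.2.2
      rw [hh]
      refine Real.abs_le_sqrt ?_
      exact Finset.single_le_sum (fun S _ => sq_nonneg (z B S : ℝ)) (Finset.mem_univ S)
    have h2 : |z B S| ≤ ⌈T⌉ := by exact_mod_cast h1.trans (Int.le_ceil T)
    exact Set.mem_Icc.2 (abs_le.1 h2)
  have : Finite I := Set.finite_range_iff hinj |>.1 hfin
  exact Set.toFinite I

theorem exists_height_map_le {n : ℕ} (e : ℕ) (M : Matrix (Fin n) (Fin n) ℤ) :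
    ∃ C : ℝ, ∀ B ∈ RationalSubspaces n e, finrank ℝ (B.map (intLin M)) = e →
      B.map (intLin M) ∈ RationalSubspaces n e ∧
        height (B.map (intLin M)) ≤ C * height B := by
  obtain ⟨a, ha⟩ := exists_plucker_intLin e M
  refine ⟨√(∑ S, ∑ T, (a S T : ℝ) ^ 2), fun B hB hM => ?_⟩
  have himage : ∀ v : Fin e → E n, Submodule.span ℝ (Set.range v) = B →
      Submodule.span ℝ (Set.range fun i => intLin M (v i)) = B.map (intLin M) := by
    rintro v rfl
    rw [Submodule.map_span, ← Set.range_comp]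
    rfl
  have hli : ∀ v : Fin e → E n, Submodule.span ℝ (Set.range v) = B →
      LinearIndependent ℝ fun i => intLin M (v i) := by
    intro v hv
    rw [linearIndependent_iff_card_eq_finrank_span, Set.finrank, himage v hv, hM, Fintype.card_fin]
  have hrat : IsRational (B.map (intLin M)) := by
    obtain ⟨v, -, hspan, hq⟩ := hB.1.exists_span_eq hB.2
    refine isRational_of_span_eq (hli v hspan) (himage v hspan) fun i j => ?_
    choose q hq using hq
    refine ⟨∑ k, (M j k : ℚ) * q i k, ?_⟩
    rw [intLin_apply]
    push_cast
    simp [hq]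
  refine ⟨⟨hrat, hM⟩, ?_⟩
  obtain ⟨v, z, c, hv, hspan, hc, hz, hh⟩ := exists_height_eq hB.1 hB.2
  have hle := height_le hrat hM (hli v hspan)
    (fun i => by rw [← himage v hspan]; exact Submodule.subset_span ⟨i, rfl⟩)
    (z := fun S => ∑ T, a S T * z T) hc fun S => by
      rw [ha, Finset.mul_sum]
      push_cast
      exact Finset.sum_congr rfl fun T _ => by rw [hz]; ring
  refine hle.trans ?_
  rw [hh, ← Real.sqrt_mul (Finset.sum_nonneg fun _ _ => Finset.sum_nonneg fun _ _ => sq_nonneg _)]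
  refine Real.sqrt_le_sqrt ?_
  rw [Finset.sum_mul]
  refine Finset.sum_le_sum fun S _ => ?_
  push_cast
  exact Finset.sum_mul_sq_le_sq_mul_sq _ _ _

/-! ### Injective perturbations of a linear map by bounded integer matrices -/

theorem euclidean_eq_sum_single {n : ℕ} (x : E n) :
    x = ∑ i, x i • EuclideanSpace.single i (1 : ℝ) := by
  ext j
  simp [Pi.single_apply]

/-- Some coordinates form a system of coordinates of a given subspace. -/
theorem exists_coordinates {n : ℕ} (K : Submodule ℝ (E n)) :
    ∃ a : Fin (finrank ℝ K) → Fin n, (∀ x ∈ K, (∀ k, x (a k) = 0) → x = 0) ∧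
      ∀ y : Fin (finrank ℝ K) → ℝ, ∃ x ∈ K, ∀ k, x (a k) = y k := by
  set φ : Fin n → Dual ℝ K := fun i =>
    (EuclideanSpace.proj i : E n →L[ℝ] ℝ).toLinearMap ∘ₗ K.subtype with hφ
  have hφa : ∀ i (x : K), φ i x = (x : E n) i := fun i x => rfl
  obtain ⟨κ, a, ha, hspan, hli⟩ := exists_linearIndependent' ℝ φ
  have : Finite κ := Finite.of_injective a ha
  have := Fintype.ofFinite κ
  have hsep : ∀ x : K, (∀ k, (x : E n) (a k) = 0) → x = 0 := by
    intro x hx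
    have h : ∀ f ∈ Submodule.span ℝ (Set.range (φ ∘ a)), f x = 0 := by
      intro f hf
      induction hf using Submodule.span_induction with
      | mem f hf => obtain ⟨k, rfl⟩ := hf; exact hx k
      | zero => rfl
      | add f g _ _ h1 h2 => rw [LinearMap.add_apply, h1, h2, add_zero]
      | smul c f _ h1 => rw [LinearMap.smul_apply, h1, smul_zero]
    ext i
    exact h (φ i) (hspan ▸ Submodule.subset_span ⟨i, rfl⟩)
  set ev : K →ₗ[ℝ] κ → ℝ := LinearMap.pi fun k => φ (a k)
  have hinj : Function.Injective ev := by
    rw [injective_iff_map_eq_zero]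
    exact fun x hx => hsep x fun k => congrFun hx k
  have hcard : Fintype.card κ = finrank ℝ K := by
    refine le_antisymm ?_ ?_
    · have := hli.fintype_card_le_finrank
      rwa [Subspace.dual_finrank_eq] at this
    · have := LinearMap.finrank_le_finrank_of_injective hinj
      rwa [finrank_fintype_fun_eq_card] at this
  have hsurj : Function.Surjective ev :=
    (LinearMap.injective_iff_surjective_of_finrank_eq_finrank
      (by rw [finrank_fintype_fun_eq_card, hcard])).1 hinj
  set σ : Fin (finrank ℝ K) ≃ κ := (finCongr hcard.symm).trans (Fintype.equivFin κ).symm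
  refine ⟨fun k => a (σ k), fun x hx h => ?_, fun y => ?_⟩
  · have := hsep ⟨x, hx⟩ fun k => by simpa using h (σ.symm k)
    exact congrArg Subtype.val this
  · obtain ⟨x, hx⟩ := hsurj (y ∘ σ.symm)
    refine ⟨x, x.2, fun k => ?_⟩
    have := congrFun hx (σ k)
    simpa [ev, hφa] using this

/-- Some vectors of the canonical basis are in direct sum with a given subspace. -/
theorem exists_complementary_coordinates {n r : ℕ} (W : Submodule ℝ (E n))
    (hr : finrank ℝ W + r ≤ n) :
    ∃ U : Fin r → Fin n, ∀ c : Fin r → ℝ,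
      ∑ k, c k • EuclideanSpace.single (U k) (1 : ℝ) ∈ W → c = 0 := by
  set φ : Fin n → E n ⧸ W := fun i => W.mkQ (EuclideanSpace.single i (1 : ℝ)) with hφ
  obtain ⟨κ, a, ha, hspan, hli⟩ := exists_linearIndependent' ℝ φ
  have : Finite κ := Finite.of_injective a ha
  have := Fintype.ofFinite κ
  have htop : Submodule.span ℝ (Set.range φ) = ⊤ := by
    rw [eq_top_iff]
    rintro y -
    obtain ⟨x, rfl⟩ := W.mkQ_surjective y
    rw [euclidean_eq_sum_single x, map_sum]
    refine Submodule.sum_mem _ fun i _ => ?_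
    rw [map_smul]
    exact Submodule.smul_mem _ _ (Submodule.subset_span ⟨i, rfl⟩)
  have hcard : r ≤ Fintype.card κ := by
    have h1 := finrank_span_eq_card hli
    rw [hspan, htop, finrank_top] at h1
    have h2 := Submodule.finrank_quotient_add_finrank W
    rw [finrank_euclideanSpace_fin] at h2
    omega
  obtain ⟨ι⟩ : Nonempty (Fin r ↪ κ) := Function.Embedding.nonempty_of_card_le (by simpa using hcard)
  refine ⟨fun k => a (ι k), fun c hc => ?_⟩
  have hli' := Fintype.linearIndependent_iff.1 (hli.comp ι ι.injective) c
  rw [← Submodule.Quotient.mk_eq_zero, ← Submodule.mkQ_apply, map_sum] at hc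
  simp only [map_smul] at hc
  exact funext (hli' hc)

theorem intLin_add {n : ℕ} (M N : Matrix (Fin n) (Fin n) ℤ) :
    intLin (M + N) = intLin M + intLin N := by
  ext x i
  rw [LinearMap.add_apply, PiLp.add_apply, intLin_apply, intLin_apply, intLin_apply,
    ← Finset.sum_add_distrib]
  refine Finset.sum_congr rfl fun j _ => ?_
  rw [Matrix.add_apply]
  push_cast
  ring

/-- Restores the dimension lost by `P` on `B`. The entries of `N` are bounded independently of `B`,
so that finitely many matrices suffice for all `B`. -/
theorem exists_injective_perturbation {n : ℕ} (P : Matrix (Fin n) (Fin n) ℤ)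
    (B : Submodule ℝ (E n)) :
    ∃ N : Matrix (Fin n) (Fin n) ℤ, (∀ i j, N i j ∈ Set.Icc (0 : ℤ) n) ∧
      finrank ℝ (B.map (intLin (P + N))) = finrank ℝ B ∧
      B.map (intLin P) ≤ B.map (intLin (P + N)) := by
  classical
  set K : Submodule ℝ (E n) := B ⊓ LinearMap.ker (intLin P) with hK
  have hdim : finrank ℝ (B.map (intLin P)) + finrank ℝ K = finrank ℝ B := by
    have h := LinearMap.finrank_range_add_finrank_ker ((intLin P).domRestrict B)
    rw [LinearMap.range_domRestrict, LinearMap.ker_domRestrict] at h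
    rw [← h]
    congr 1
    have h2 : K = ((LinearMap.ker (intLin P)).comap B.subtype).map B.subtype := by
      rw [Submodule.map_comap_subtype]
    rw [h2]
    exact Submodule.finrank_map_subtype_eq _ _
  obtain ⟨a, ha0, ha⟩ := exists_coordinates K
  obtain ⟨U, hU⟩ := exists_complementary_coordinates (r := finrank ℝ K) (B.map (intLin P)) (by
    rw [hdim]
    simpa using Submodule.finrank_le B)
  -- `N` reads the coordinates that parametrize the kernel `K` and writes them on basis vectors
  -- independent of the image of `B`.
  set N : Matrix (Fin n) (Fin n) ℤ :=
    Matrix.of fun i j => ∑ k, if a k = j ∧ U k = i then 1 else 0 with hN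
  have hNx : ∀ x, intLin N x = ∑ k, x (a k) • EuclideanSpace.single (U k) (1 : ℝ) := by
    intro x
    ext i
    rw [intLin_apply]
    simp only [hN, Matrix.of_apply, Int.cast_sum, Finset.sum_mul]
    rw [Finset.sum_comm]
    simp only [WithLp.ofLp_sum, Finset.sum_apply]
    refine Finset.sum_congr rfl fun k _ => ?_
    rw [Finset.sum_eq_single (a k)]
    · by_cases h : U k = i
      · simp [h]
      · simp [h, Ne.symm h]
    · intro j _ hj
      simp [hj.symm]
    · simp
  refine ⟨N, fun i j => ⟨?_, ?_⟩, ?_, ?_⟩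
  · simp only [hN, Matrix.of_apply]
    exact Finset.sum_nonneg fun k _ => by split_ifs <;> simp
  · have hKn : finrank ℝ K ≤ n := by simpa using Submodule.finrank_le K
    simp only [hN, Matrix.of_apply]
    refine (Finset.sum_le_card_nsmul _ _ 1 fun k _ => by split_ifs <;> simp).trans ?_
    simpa using hKn
  · have hinj : Function.Injective ((intLin (P + N)).domRestrict B) := by
      rw [injective_iff_map_eq_zero]
      rintro ⟨x, hx⟩ h
      rw [LinearMap.domRestrict_apply, intLin_add, LinearMap.add_apply, hNx] at h
      have hmem : ∑ k, x (a k) • EuclideanSpace.single (U k) (1 : ℝ) ∈ B.map (intLin P) := by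
        rw [eq_neg_of_add_eq_zero_right h]
        exact Submodule.neg_mem _ ⟨x, hx, rfl⟩
      have hxa := hU (fun k => x (a k)) hmem
      have h0 : ∑ k, x (a k) • EuclideanSpace.single (U k) (1 : ℝ) = 0 :=
        Finset.sum_eq_zero fun k _ => by rw [congrFun hxa k, Pi.zero_apply, zero_smul]
      rw [h0, add_zero] at h
      exact Subtype.ext (ha0 x ⟨hx, h⟩ (congrFun hxa))
    rw [← LinearMap.finrank_range_of_inj hinj, LinearMap.range_domRestrict]
  · rintro _ ⟨x, hx, rfl⟩
    obtain ⟨k, hk, hkx⟩ := ha fun i => x (a i)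
    -- Subtracting the element of `K` with the same coordinates makes the `N`-part vanish without
    -- changing the image by `P`.
    refine ⟨x - k, B.sub_mem hx hk.1, ?_⟩
    have h1 : intLin P k = 0 := hk.2
    rw [intLin_add, LinearMap.add_apply, hNx, map_sub, h1]
    simp [hkx]

/-! ### Rational projections -/

/-- Rational bases of the `R_j` together stay independent over `ℚ`, so the projection can be
prescribed on them and extended to `ℚⁿ`; `D` clears its denominators. -/
theorem exists_intLin_projection {n d : ℕ} {R : Fin d → Submodule ℝ (E n)}
    (hR : ∀ j, IsRational (R j)) (hsum : iSupIndep R) (J : Finset (Fin d)) :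
    ∃ (D : ℤ) (P : Matrix (Fin n) (Fin n) ℤ), D ≠ 0 ∧
      (∀ j ∈ J, ∀ x ∈ R j, intLin P x = (D : ℝ) • x) ∧
      ∀ j ∉ J, ∀ x ∈ R j, intLin P x = 0 := by
  classical
  choose v hv hspan hq using fun j => (hR j).exists_span_eq rfl
  choose q hq using hq
  have hli : LinearIndependent ℝ
      fun s : Σ j, Fin (finrank ℝ (R j)) => v s.1 s.2 := by
    refine linearIndependent_iUnion_finite hv fun i t _ hit => ?_
    simp only [hspan]
    exact hsum.disjoint_biSup hit
  have hliq : LinearIndependent ℚ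
      fun s : Σ j, Fin (finrank ℝ (R j)) => q s.1 s.2 := by
    rw [Fintype.linearIndependent_iff] at hli ⊢
    intro c hc s
    have := hli (fun s => (c s : ℝ)) (by
      ext k
      have := congrArg (Rat.cast (K := ℝ)) (congrFun hc k)
      simpa [hq] using this) s
    exact_mod_cast this
  obtain ⟨φ, hφ⟩ : ∃ φ : (Fin n → ℚ) →ₗ[ℚ] (Fin n → ℚ), ∀ s : Σ j, Fin (finrank ℝ (R j)),
      φ (q s.1 s.2) = if s.1 ∈ J then q s.1 s.2 else 0 := by
    obtain ⟨φ, hφ⟩ := LinearMap.exists_extend ((Basis.span hliq).constr ℚ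
      fun s => if s.1 ∈ J then q s.1 s.2 else 0)
    refine ⟨φ, fun s => ?_⟩
    have h := LinearMap.congr_fun hφ (Basis.span hliq s)
    rw [Basis.constr_basis] at h
    rw [← h]
    simp [Basis.span_apply]
  obtain ⟨⟨D, hD⟩, hDp⟩ := IsLocalization.exist_integer_multiples_of_finite (nonZeroDivisors ℤ)
    fun s : Fin n × Fin n => LinearMap.toMatrix' φ s.1 s.2
  choose z hz using hDp
  have hz' : ∀ i j, (z (i, j) : ℚ) = D * LinearMap.toMatrix' φ i j := by
    intro i j
    simpa [Algebra.smul_def] using hz (i, j)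
  have hP : ∀ j i, intLin (Matrix.of fun i j => z (i, j)) (v j i)
      = if j ∈ J then (D : ℝ) • v j i else 0 := by
    intro j i
    ext k
    have h1 := congrFun (hφ ⟨j, i⟩) k
    rw [← LinearMap.toMatrix'_mulVec φ] at h1
    simp only [Matrix.mulVec, dotProduct] at h1
    have h2 := congrArg (fun t : ℚ => ((D * t : ℚ) : ℝ)) h1
    simp only [Finset.mul_sum, ← mul_assoc, ← hz'] at h2
    rw [intLin_apply]
    push_cast at h2
    simp only [Matrix.of_apply, hq]
    rw [h2]
    split_ifs <;> simp [hq]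
  refine ⟨D, Matrix.of fun i j => z (i, j), nonZeroDivisors.ne_zero hD, fun j hj x hx => ?_,
    fun j hj x hx => ?_⟩
  · rw [← hspan j] at hx
    induction hx using Submodule.span_induction with
    | mem x hx => obtain ⟨i, rfl⟩ := hx; rw [hP, if_pos hj]
    | zero => simp
    | add x y _ _ h1 h2 => rw [map_add, h1, h2, smul_add]
    | smul c x _ h1 => rw [map_smul, h1, smul_comm]
  · rw [← hspan j] at hx
    induction hx using Submodule.span_induction with
    | mem x hx => obtain ⟨i, rfl⟩ := hx; rw [hP, if_neg hj]
    | zero => simp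
    | add x y _ _ h1 h2 => rw [map_add, h1, h2, add_zero]
    | smul c x _ h1 => rw [map_smul, h1, smul_zero]

/-! ### Dominant coordinates of a subspace -/

theorem exists_dominant_coordinates {d l : ℕ} (V : Submodule ℝ (E d)) (hl : finrank ℝ V = l) :
    ∃ J : Finset (Fin d), J.card = l ∧
      ∀ a : E d, ∃ x ∈ V, (∀ j ∈ J, x j = a j) ∧ ∀ i, |x i| ≤ ∑ j ∈ J, |a j| := by
  classical
  subst hl
  set b := finBasis ℝ V
  -- All index maps `f` are allowed, not only increasing ones, so that replacing one column, as
  -- Cramer's rule does, stays in the family over which the minor is maximal.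
  set M : (Fin (finrank ℝ V) → Fin d) → Matrix (Fin (finrank ℝ V)) (Fin (finrank ℝ V)) ℝ :=
    fun f => Matrix.of fun i j => (b i : E d) (f j) with hM
  have hb : LinearIndependent ℝ fun i => (b i : E d) :=
    b.linearIndependent.map' V.subtype (by simp)
  obtain ⟨S, hS⟩ := exists_plucker_ne_zero hb
  have : Nonempty (Fin (finrank ℝ V) → Fin d) := ⟨S⟩
  obtain ⟨f, hf⟩ := Finite.exists_max fun f => |(M f).det|
  have hdet : 0 < |(M f).det| := (abs_pos.2 hS).trans_le (hf S)
  have hdet0 : (M f).det ≠ 0 := abs_pos.1 hdet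
  have hfinj : Function.Injective f := by
    intro i j hij
    by_contra hne
    exact hdet0 (Matrix.det_zero_of_column_eq hne fun k => by simp [hM, hij])
  have hJ : (Finset.univ.image f).card = finrank ℝ V := by
    rw [Finset.card_image_of_injective _ hfinj, Finset.card_univ, Fintype.card_fin]
  refine ⟨Finset.univ.image f, hJ, fun a => ?_⟩
  set t : Fin (finrank ℝ V) → ℝ := Matrix.vecMul (fun k => a (f k)) (M f)⁻¹ with ht
  have htM : Matrix.vecMul t (M f) = fun k => a (f k) := by
    rw [ht, Matrix.vecMul_vecMul, Matrix.nonsing_inv_mul _ (isUnit_iff_ne_zero.2 hdet0),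
      Matrix.vecMul_one]
  have hx : ∀ j, (∑ i, t i • (b i : E d)) j = ∑ i, t i * (b i : E d) j := by
    intro j
    simp
  refine ⟨∑ i, t i • (b i : E d), V.sum_mem fun i _ => V.smul_mem _ (b i).2, ?_, fun j => ?_⟩
  · intro j hj
    obtain ⟨k, -, rfl⟩ := Finset.mem_image.1 hj
    rw [hx]
    exact congrFun htM k
  · set col : Fin (finrank ℝ V) → ℝ := fun i => (b i : E d) j
    set w := (M f).cramer col with hw
    have hwk : ∀ k, |w k| ≤ |(M f).det| := by
      intro k
      rw [hw, Matrix.cramer_apply]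
      have : (M f).updateCol k col = M (Function.update f k j) := by
        ext i m
        by_cases h : m = k
        · subst h; simp [hM, col]
        · simp [hM, h]
      rw [this]
      exact hf _
    have hcol : (M f).det • col = (M f).mulVec w := (Matrix.mulVec_cramer _ _).symm
    have hxj : (M f).det * (∑ i, t i • (b i : E d)) j = ∑ k, a (f k) * w k := by
      rw [hx]
      calc (M f).det * (t ⬝ᵥ col) = t ⬝ᵥ (M f).mulVec w := by
            rw [← hcol, dotProduct_smul, smul_eq_mul]
        _ = (fun k => a (f k)) ⬝ᵥ w := by rw [Matrix.dotProduct_mulVec, htM]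
    refine le_of_mul_le_mul_left ?_ hdet
    rw [← abs_mul, hxj, Finset.sum_image hfinj.injOn, Finset.mul_sum]
    refine (Finset.abs_sum_le_sum_abs _ _).trans (Finset.sum_le_sum fun k _ => ?_)
    rw [abs_mul, mul_comm]
    exact mul_le_mul_of_nonneg_right (hwk k) (abs_nonneg _)

/-! ### From subspaces close to `A` to subspaces close to some `A_J` -/

theorem exists_mem_span_of_finrank_eq_one {n : ℕ} {L : Submodule ℝ (E n)} (hL : finrank ℝ L = 1) :
    ∃ u ∈ L, u ≠ 0 ∧ ∀ x ∈ L, ∃ c : ℝ, x = c • u := by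
  obtain ⟨u, hu, h⟩ := finrank_eq_one_iff'.1 hL
  refine ⟨u, u.2, by simpa using hu, fun x hx => ?_⟩
  obtain ⟨c, hc⟩ := h ⟨x, hx⟩
  exact ⟨c, (congrArg Subtype.val hc).symm⟩

/-- The linear map `x ↦ ∑ xⱼ uⱼ`. -/
noncomputable def combination {n d : ℕ} (u : Fin d → E n) : E d →ₗ[ℝ] E n :=
  Fintype.linearCombination ℝ u ∘ₗ (WithLp.linearEquiv 2 ℝ (Fin d → ℝ)).toLinearMap

theorem combination_apply {n d : ℕ} (u : Fin d → E n) (x : E d) :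
    combination u x = ∑ j, x j • u j := rfl

theorem combination_injective {n d : ℕ} {u : Fin d → E n} (hu : LinearIndependent ℝ u) :
    Function.Injective (combination u) := by
  rw [injective_iff_map_eq_zero]
  intro x hx
  ext j
  exact Fintype.linearIndependent_iff.1 hu _ hx j

theorem exists_combination_eq {n d : ℕ} {L : Fin d → Submodule ℝ (E n)} {u : Fin d → E n}
    (hu : ∀ j, ∀ x ∈ L j, ∃ c : ℝ, x = c • u j) {J : Finset (Fin d)} {a : E n}
    (ha : a ∈ partialSum L J) : ∃ x : E d, combination u x = a ∧ ∀ j ∉ J, x j = 0 := by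
  classical
  set W : Submodule ℝ (E d) := ⨅ j ∈ {j | j ∉ J}, LinearMap.ker
    (EuclideanSpace.proj j : E d →L[ℝ] ℝ).toLinearMap
  have hW : ∀ x, x ∈ W ↔ ∀ j ∉ J, x j = 0 := by
    intro x
    simp [W, Submodule.mem_iInf]
  have hle : partialSum L J ≤ W.map (combination u) := by
    refine iSup₂_le fun j hj x hx => ?_
    obtain ⟨c, rfl⟩ := hu j x hx
    refine ⟨EuclideanSpace.single j c, (hW _).2 fun i hi => ?_, ?_⟩
    · have : i ≠ j := by rintro rfl; exact hi hj
      simp [this]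
    · rw [combination_apply, Finset.sum_eq_single j]
      · simp
      · intro i _ hi
        simp [hi]
      · simp
  obtain ⟨x, hx, hxa⟩ := hle ha
  exact ⟨x, hxa, (hW x).1 hx⟩

theorem partialSum_univ {n d : ℕ} (L : Fin d → Submodule ℝ (E n)) :
    partialSum L Finset.univ = ⨆ j, L j := by
  simp [partialSum]

theorem finrank_partialSum {n d : ℕ} {L : Fin d → Submodule ℝ (E n)} (hL : iSupIndep L)
    (hL1 : ∀ j, finrank ℝ (L j) = 1) (J : Finset (Fin d)) :
    finrank ℝ (partialSum L J) = J.card := by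
  choose u huL hu0 hu using fun j => exists_mem_span_of_finrank_eq_one (hL1 j)
  have hli : LinearIndependent ℝ u := hL.linearIndependent L huL hu0
  have hspan : partialSum L J = Submodule.span ℝ (Set.range fun j : J => u j) := by
    refine le_antisymm (iSup₂_le fun j hj x hx => ?_) (Submodule.span_le.2 ?_)
    · obtain ⟨c, rfl⟩ := hu j x hx
      exact Submodule.smul_mem _ _ (Submodule.subset_span ⟨⟨j, hj⟩, rfl⟩)
    · rintro _ ⟨j, rfl⟩
      exact (le_iSup₂ (f := fun j (_ : j ∈ J) => L j) j.1 j.2) (huL j)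
  have hliJ : LinearIndependent ℝ fun j : J => u j := hli.comp _ Subtype.val_injective
  rw [hspan, finrank_span_eq_card hliJ, Fintype.card_coe]

/-- Lifting the vectors of a coordinate subspace to a given subspace, with bounded norms. -/
theorem exists_bounded_lift {n d : ℕ} {u : Fin d → E n} (hu : LinearIndependent ℝ u) :
    ∃ C : ℝ, 0 ≤ C ∧ ∀ (l : ℕ) (V : Submodule ℝ (E n)), V ≤ LinearMap.range (combination u) →
      finrank ℝ V = l → ∃ J : Finset (Fin d), J.card = l ∧ ∀ a : E d, ∃ x : E d,
        combination u x ∈ V ∧ (∀ j ∈ J, x j = a j) ∧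
          ‖combination u x‖ ≤ C * ‖combination u a‖ := by
  obtain ⟨K, -, hK⟩ := (combination u).exists_antilipschitzWith
    (LinearMap.ker_eq_bot.2 (combination_injective hu))
  have hKn : ∀ a, ‖a‖ ≤ K * ‖combination u a‖ := fun a => hK.le_mul_norm (by simp) a
  refine ⟨(∑ i, ‖u i‖) * (d * K), by positivity, fun l V hV hl => ?_⟩
  have hmap : (V.comap (combination u)).map (combination u) = V := by
    rw [Submodule.map_comap_eq, inf_eq_right.2 hV]
  obtain ⟨J, hJ, h⟩ := exists_dominant_coordinates (l := l) (V.comap (combination u)) (by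
    rw [← hl]
    conv_rhs => rw [← hmap]
    exact (Submodule.equivMapOfInjective _ (combination_injective hu) _).finrank_eq)
  refine ⟨J, hJ, fun a => ?_⟩
  obtain ⟨x, hxV, hxJ, hx⟩ := h a
  refine ⟨x, hxV, hxJ, ?_⟩
  have hsum : ∑ j ∈ J, |a j| ≤ d * ‖a‖ := by
    refine (Finset.sum_le_card_nsmul J _ ‖a‖ fun j _ => PiLp.norm_apply_le a j).trans ?_
    rw [nsmul_eq_mul]
    refine mul_le_mul_of_nonneg_right ?_ (norm_nonneg _)
    exact_mod_cast (Finset.card_le_univ J).trans (by simp)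
  rw [combination_apply, mul_assoc, Finset.sum_mul]
  refine (norm_sum_le _ _).trans (Finset.sum_le_sum fun i _ => ?_)
  rw [norm_smul, Real.norm_eq_abs, mul_comm]
  refine mul_le_mul_of_nonneg_left ((hx i).trans (hsum.trans ?_)) (norm_nonneg _)
  rw [mul_assoc]
  exact mul_le_mul_of_nonneg_left (hKn a) (by positivity)

/-- The perturbation depends on `B` but ranges over a finite set, so the largest of finitely many
constants works for all `B`. -/
theorem exists_uniform_height_map_le (n e : ℕ) {ι : Type*} [Finite ι]
    (P : ι → Matrix (Fin n) (Fin n) ℤ) :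
    ∃ C : ℝ, 0 ≤ C ∧ ∀ i, ∀ B ∈ RationalSubspaces n e, ∃ B' ∈ RationalSubspaces n e,
      B.map (intLin (P i)) ≤ B' ∧ height B' ≤ C * height B := by
  set 𝓝 : Set (Matrix (Fin n) (Fin n) ℤ) := {N | ∀ i j, N i j ∈ Set.Icc (0 : ℤ) n}
  have hfin : 𝓝.Finite := Set.Finite.pi' fun _ => Set.Finite.pi' fun _ => Set.finite_Icc _ _
  have := hfin.to_subtype
  choose c hc using fun p : ι × 𝓝 => exists_height_map_le e (P p.1 + p.2.1)
  obtain ⟨C, hC⟩ := (Set.finite_range c).bddAbove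
  refine ⟨max C 0, le_max_right _ _, fun i B hB => ?_⟩
  obtain ⟨N, hN, hdim, hle⟩ := exists_injective_perturbation (P i) B
  obtain ⟨h1, h2⟩ := hc (i, ⟨N, hN⟩) B hB (hdim.trans hB.2)
  refine ⟨_, h1, hle, h2.trans (mul_le_mul_of_nonneg_right ?_ (Real.sqrt_nonneg _))⟩
  exact (hC ⟨_, rfl⟩).trans (le_max_left _ _)

/-- The core of the proof. `C` depends on neither `B` nor `V`, and `J` and `B'` are chosen before
`ε`; the case `ε = 0` turns an inclusion `V ⊂ B` into `A_J ⊂ B'`. -/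
theorem exists_transfer {n d : ℕ} {R L : Fin d → Submodule ℝ (E n)}
    (hRrat : ∀ j, IsRational (R j)) (hRsum : iSupIndep R) (hLR : ∀ j, L j ≤ R j)
    (hL1 : ∀ j, finrank ℝ (L j) = 1) (e l : ℕ) :
    ∃ C : ℝ, 0 < C ∧ ∀ B ∈ RationalSubspaces n e, ∀ V ≤ ⨆ j, L j, finrank ℝ V = l →
      ∃ J : Finset (Fin d), J.card = l ∧ ∃ B' ∈ RationalSubspaces n e,
        height B' ≤ C * height B ∧ ∀ ε : ℝ, 0 ≤ ε →
          (∀ x ∈ V, ∃ y ∈ B, ‖x - y‖ ≤ ε * ‖x‖) →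
          ∀ a ∈ partialSum L J, ∃ y ∈ B', ‖a - y‖ ≤ C * ε * ‖a‖ := by
  choose u huL hu0 hu using fun j => exists_mem_span_of_finrank_eq_one (hL1 j)
  have hli : LinearIndependent ℝ u := (hRsum.mono hLR).linearIndependent L huL hu0
  choose D P hD hPJ hPJ' using fun J => exists_intLin_projection hRrat hRsum J
  obtain ⟨C₁, hC₁, hlift⟩ := exists_bounded_lift hli
  obtain ⟨C₂, hC₂, hheight⟩ := exists_uniform_height_map_le n e P
  set T : Finset (Fin d) → E n →L[ℝ] E n :=
    fun J => LinearMap.toContinuousLinearMap ((D J : ℝ)⁻¹ • intLin (P J)) with hT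
  obtain ⟨C₃, hC₃⟩ := (Set.finite_range fun J => ‖T J‖).bddAbove
  have hC₃' : ∀ J, ‖T J‖ ≤ C₃ := fun J => hC₃ ⟨J, rfl⟩
  have hC₃0 : 0 ≤ C₃ := (norm_nonneg _).trans (hC₃' ∅)
  refine ⟨C₂ + C₃ * C₁ + 1, by positivity, fun B hB V hV hl => ?_⟩
  obtain ⟨J, hJ, hJV⟩ := hlift l V (fun v hv => by
    obtain ⟨x, hx, -⟩ := exists_combination_eq hu (J := Finset.univ) (a := v)
      (by rw [partialSum_univ]; exact hV hv)
    exact ⟨x, hx⟩) hl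
  obtain ⟨B', hB', hPB, hh⟩ := hheight J B hB
  refine ⟨J, hJ, B', hB', hh.trans (mul_le_mul_of_nonneg_right ?_ (Real.sqrt_nonneg _)),
    fun ε hε hVB a ha => ?_⟩
  · linarith [mul_nonneg hC₃0 hC₁]
  obtain ⟨a', rfl, ha'⟩ := exists_combination_eq hu ha
  obtain ⟨x, hxV, hxJ, hx⟩ := hJV a'
  obtain ⟨y, hy, hxy⟩ := hVB _ hxV
  have hDJ : (D J : ℝ) ≠ 0 := by exact_mod_cast hD J
  -- `T J` fixes `u_j` for `j ∈ J` and kills the others, while `x` agrees with `a'` on `J` and `a'`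
  -- vanishes off `J`.
  have hTx : T J (combination u x) = combination u a' := by
    rw [combination_apply, combination_apply, map_sum]
    refine Finset.sum_congr rfl fun j _ => ?_
    rw [map_smul]
    change x j • (D J : ℝ)⁻¹ • intLin (P J) (u j) = _
    by_cases hj : j ∈ J
    · rw [hPJ J j hj _ (hLR j (huL j)), inv_smul_smul₀ hDJ, hxJ j hj]
    · rw [hPJ' J j hj _ (hLR j (huL j)), ha' j hj, smul_zero, smul_zero, zero_smul]
  refine ⟨T J y, B'.smul_mem _ (hPB ⟨y, hy, rfl⟩), ?_⟩
  rw [← hTx, ← map_sub, hTx]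
  calc ‖T J (combination u x - y)‖ ≤ C₃ * (ε * (C₁ * ‖combination u a'‖)) := by
        refine (T J).le_of_opNorm_le_of_le (hC₃' J) (hxy.trans ?_)
        exact mul_le_mul_of_nonneg_left hx hε
    _ = C₃ * C₁ * (ε * ‖combination u a'‖) := by ring
    _ ≤ (C₂ + C₃ * C₁ + 1) * (ε * ‖combination u a'‖) :=
        mul_le_mul_of_nonneg_right (by linarith) (by positivity)
    _ = _ := by ring

/-! ### Comparison of exponents -/

/-- Multiplicative constants do not affect exponents: any `r < μ` leaves a power of the height to
absorb them. -/
theorem exponent_le_iSup {n e j : ℕ} {A : Submodule ℝ (E n)} {ι : Type*} [Finite ι]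
    {A' : ι → Submodule ℝ (E n)} {j' : ι → ℕ} {C : ℝ} (hC : 0 < C)
    (h : ∀ B ∈ RationalSubspaces n e, ∃ i, ∃ B' ∈ RationalSubspaces n e,
      height B' ≤ C * height B ∧ psi (j' i) (A' i) B' ≤ C * psi j A B)
    (hpos : ∀ i, ∀ B ∈ RationalSubspaces n e, 0 < psi (j' i) (A' i) B) :
    exponent A e j ≤ ⨆ i, exponent (A' i) e (j' i) := by
  refine sSup_le ?_
  rintro _ ⟨μ, ⟨hμ, hinf⟩, rfl⟩
  refine ENNReal.le_of_forall_nnreal_lt fun r hr => ?_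
  rcases eq_or_ne r 0 with rfl | hr0
  · simp
  have hr0' : (0 : ℝ) < r := by positivity
  have hrμ : (r : ℝ) < μ := by
    rw [← ENNReal.ofReal_coe_nnreal] at hr
    exact (ENNReal.ofReal_lt_ofReal_iff hμ).1 hr
  have : Nonempty ι := by
    obtain ⟨B, hB⟩ := hinf.nonempty
    exact ⟨(h B hB.1).choose⟩
  choose! i B' hB' hh hψ using h
  set I := {B ∈ RationalSubspaces n e | psi j A B ≤ height B ^ (-μ)} with hI
  obtain ⟨i₀, hi₀⟩ : ∃ i₀, {B ∈ I | i B = i₀}.Infinite := by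
    by_contra! hfin
    refine hinf ((Set.finite_iUnion hfin).subset fun B hB => ?_)
    exact Set.mem_iUnion.2 ⟨i B, hB, rfl⟩
  set S := {B ∈ I | i B = i₀} with hS
  have hSψ : ∀ B ∈ S, psi (j' i₀) (A' i₀) (B' B) ≤ C * height B ^ (-μ) := by
    rintro B ⟨⟨hB, hBμ⟩, rfl⟩
    exact (hψ B hB).trans (mul_le_mul_of_nonneg_left hBμ hC.le)
  -- If only finitely many `B'` occurred, positivity would bound `ψ` below by some `δ > 0`, hence
  -- bound the heights of infinitely many `B`.
  have himage : (B' '' S).Infinite := by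
    intro hfin
    obtain ⟨B₀, hB₀⟩ := hi₀.nonempty
    obtain ⟨Bm, hBm, hmin⟩ := Set.exists_min_image _ (psi (j' i₀) (A' i₀)) hfin ⟨_, B₀, hB₀, rfl⟩
    obtain ⟨B₁, hB₁, rfl⟩ := hBm
    set δ := psi (j' i₀) (A' i₀) (B' B₁)
    have hδ : 0 < δ := hpos i₀ _ (hB' B₁ hB₁.1.1)
    refine hi₀ ((finite_height_le n e ((C / δ) ^ (1 / μ))).subset fun B hB => ⟨hB.1.1, ?_⟩)
    have h1 : 0 < height B := zero_lt_one.trans_le (one_le_height hB.1.1.1)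
    have h2 : δ ≤ C * height B ^ (-μ) := (hmin _ ⟨B, hB, rfl⟩).trans (hSψ B hB)
    rw [Real.rpow_neg h1.le] at h2
    have h3 : 0 < height B ^ μ := Real.rpow_pos_of_pos h1 _
    have h4 : height B ^ μ ≤ C / δ := by
      rw [le_div_iff₀ hδ]
      rw [← div_eq_mul_inv, le_div_iff₀ h3] at h2
      linarith
    calc height B = (height B ^ μ) ^ (1 / μ) := by
          rw [← Real.rpow_mul h1.le, mul_one_div_cancel hμ.ne', Real.rpow_one]
      _ ≤ (C / δ) ^ (1 / μ) := Real.rpow_le_rpow h3.le h4 (by positivity)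
  refine le_trans ?_ (le_iSup _ i₀)
  rw [← ENNReal.ofReal_coe_nnreal]
  refine le_sSup ⟨r, ⟨hr0', ?_⟩, rfl⟩
  -- Beyond this height, `H(B')^(μ - r)` exceeds the total constant `C^(1 + μ)`.
  set T : ℝ := (C ^ (1 + μ)) ^ (1 / (μ - r)) with hT
  refine (himage.sdiff (finite_height_le n e T)).mono ?_
  rintro _ ⟨⟨B, hB, rfl⟩, hBT⟩
  have hBr := hB.1.1
  refine ⟨hB' B hBr, (hSψ B hB).trans ?_⟩
  have hTlt : T < height (B' B) := by
    by_contra! hle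
    exact hBT ⟨hB' B hBr, hle⟩
  have h1 : 0 < height B := zero_lt_one.trans_le (one_le_height hBr.1)
  have h1' : 0 < height (B' B) := zero_lt_one.trans_le (one_le_height (hB' B hBr).1)
  have h2 : height B ^ (-μ) ≤ C ^ μ * height (B' B) ^ (-μ) := by
    have h3 : height (B' B) ^ μ ≤ C ^ μ * height B ^ μ := by
      rw [← Real.mul_rpow hC.le h1.le]
      exact Real.rpow_le_rpow h1'.le (hh B hBr) hμ.le
    have := Real.rpow_pos_of_pos h1 μ
    have := Real.rpow_pos_of_pos h1' μ
    rw [Real.rpow_neg h1.le, Real.rpow_neg h1'.le, ← div_eq_mul_inv, inv_eq_one_div,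
      div_le_div_iff₀ ‹_› ‹_›]
    linarith
  have hCpos : 0 < C ^ (1 + μ) := Real.rpow_pos_of_pos hC _
  have h4 : C ^ (1 + μ) ≤ height (B' B) ^ (μ - r) := by
    calc C ^ (1 + μ) = T ^ (μ - r) := by
          rw [hT, ← Real.rpow_mul hCpos.le, one_div_mul_cancel (by linarith), Real.rpow_one]
      _ ≤ _ := Real.rpow_le_rpow (Real.rpow_nonneg hCpos.le _) hTlt.le (by linarith)
  calc C * height B ^ (-μ) ≤ C * (C ^ μ * height (B' B) ^ (-μ)) :=
        mul_le_mul_of_nonneg_left h2 hC.le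
    _ = C ^ (1 + μ) * height (B' B) ^ (-μ) := by
        rw [Real.rpow_add hC, Real.rpow_one, mul_assoc]
    _ ≤ height (B' B) ^ (μ - r) * height (B' B) ^ (-μ) :=
        mul_le_mul_of_nonneg_right h4 (Real.rpow_nonneg h1'.le _)
    _ = height (B' B) ^ (-(r : ℝ)) := by
        rw [← Real.rpow_add h1']
        congr 1
        ring

/-- A vanishing `l`-th angle would place a subspace of dimension `l` inside `A ⊓ B`. -/
theorem angle_pos {n l : ℕ} {A B : Submodule ℝ (E n)} (hA : l ≤ finrank ℝ A)
    (hB : l ≤ finrank ℝ B) (h : finrank ℝ ↥(A ⊓ B) < l) : 0 < angle l A B := by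
  refine (angle_nonneg l A B).lt_of_ne' fun h0 => ?_
  obtain ⟨V, hVA, hVl, hV⟩ := exists_le_of_angle l A B hA hB
  have hVB : V ≤ B := fun x hx => by
    obtain ⟨y, hy, hxy⟩ := hV x hx
    rw [h0, mul_zero, zero_mul, norm_le_zero_iff, sub_eq_zero] at hxy
    rwa [hxy]
  have := Submodule.finrank_mono (le_inf hVA hVB)
  omega

theorem exists_le_finrank_eq {n l : ℕ} {A : Submodule ℝ (E n)} (hA : l ≤ finrank ℝ A) :
    ∃ V ≤ A, finrank ℝ V = l := by
  obtain ⟨V, hV, hl, -⟩ := exists_le_of_angle l A A hA hA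
  exact ⟨V, hV, hl⟩

end DiophSub

/-! ### Proof of the theorem -/

open DiophSub
theorem mainTheorem6 (n d : ℕ) (hd1 : 1 ≤ d) (hdn : d ≤ n / 2)
    (R L : Fin d → Submodule ℝ (E n))
    (hRrat : ∀ j, IsRational (R j))
    (hRsum : iSupIndep R)
    (hLR : ∀ j, L j ≤ R j)
    (hL1 : ∀ j, Module.finrank ℝ (L j) = 1)
    (A : Submodule ℝ (E n)) (hA : A = ⨆ j, L j)
    (e k : ℕ) (he1 : 1 ≤ e) (hen : e ≤ n - 1)
    (hk1 : 1 ≤ k) (hk : k ≤ min d e - g (Module.finrank ℝ A) e n) :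
    (IsIrrational A e k ↔
      ∀ J : Finset (Fin d), J.card = k + g (Module.finrank ℝ A) e n →
        IsIrrational (partialSum L J) e
          (k + g (Module.finrank ℝ A) e n - g (Module.finrank ℝ (partialSum L J)) e n)) ∧
    (IsIrrational A e k →
      IsGreatest
        {x : ENNReal | ∃ J : Finset (Fin d), J.card = k + g (Module.finrank ℝ A) e n ∧
          x = exponent (partialSum L J) e
            (k + g (Module.finrank ℝ A) e n - g (Module.finrank ℝ (partialSum L J)) e n)}
        (exponent A e k)) := by
  have hLind : iSupIndep L := hRsum.mono hLR
  have hfinJ := finrank_partialSum hLind hL1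
  have hfinA : Module.finrank ℝ A = d := by
    rw [hA, ← partialSum_univ, hfinJ, Finset.card_univ, Fintype.card_fin]
  have hAJ : ∀ J, partialSum L J ≤ A := fun J => by
    rw [hA]
    exact iSup₂_le fun j _ => le_iSup L j
  obtain ⟨l, hl⟩ : ∃ l, l = k + g (Module.finrank ℝ A) e n := ⟨_, rfl⟩
  have hl1 : 1 ≤ l := by omega
  have hld : l ≤ d := by omega
  have hle : l ≤ e := by omega
  -- The truncated subtraction is harmless: `e ≤ n` gives `g(l, e, n) ≤ l`.
  have hlJ : ∀ J : Finset (Fin d), J.card = l →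
      l - g (Module.finrank ℝ (partialSum L J)) e n + g (Module.finrank ℝ (partialSum L J)) e n
        = l := by
    intro J hJ
    rw [hfinJ, hJ]
    unfold g
    omega
  have hψA : ∀ B ∈ RationalSubspaces n e, psi k A B = angle l A B := by
    intro B hB
    rw [psi, hB.2, ← hl]
  have hψJ : ∀ J : Finset (Fin d), J.card = l → ∀ B ∈ RationalSubspaces n e,
      psi (l - g (Module.finrank ℝ (partialSum L J)) e n) (partialSum L J) B
        = angle l (partialSum L J) B := by
    intro J hJ B hB
    rw [psi, hB.2, hlJ J hJ]
  have hirrA : IsIrrational A e k ↔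
      ∀ B ∈ RationalSubspaces n e, Module.finrank ℝ ↥(A ⊓ B) < l := by
    rw [IsIrrational, ← hl]
  have hirrJ : ∀ J : Finset (Fin d), J.card = l →
      (IsIrrational (partialSum L J) e (l - g (Module.finrank ℝ (partialSum L J)) e n) ↔
        ∀ B ∈ RationalSubspaces n e, Module.finrank ℝ ↥(partialSum L J ⊓ B) < l) := by
    intro J hJ
    rw [IsIrrational, hlJ J hJ]
  rw [← hl]
  obtain ⟨C, hC, htransfer⟩ := exists_transfer hRrat hRsum hLR hL1 e l
  have hAJirr : IsIrrational A e k → ∀ J : Finset (Fin d), J.card = l →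
      IsIrrational (partialSum L J) e (l - g (Module.finrank ℝ (partialSum L J)) e n) := by
    intro h J hJ
    rw [hirrJ J hJ]
    exact fun B hB =>
      (Submodule.finrank_mono (inf_le_inf_right B (hAJ J))).trans_lt (hirrA.1 h B hB)
  refine ⟨⟨hAJirr, fun h => ?_⟩, fun h => ?_⟩
  · rw [hirrA]
    intro B hB
    by_contra! hlB
    obtain ⟨V, hVAB, hVl⟩ := exists_le_finrank_eq hlB
    obtain ⟨J, hJ, B', hB', -, hclose⟩ :=
      htransfer B hB V (hA ▸ hVAB.trans inf_le_left) hVl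
    have hsub : partialSum L J ≤ B' := fun a ha => by
      obtain ⟨y, hy, hay⟩ := hclose 0 le_rfl
        (fun x hx => ⟨x, (hVAB hx).2, by simp⟩) a ha
      rw [mul_zero, zero_mul, norm_le_zero_iff, sub_eq_zero] at hay
      rwa [hay]
    have := (hirrJ J hJ).1 (h J hJ) B' hB'
    rw [inf_eq_left.2 hsub, hfinJ, hJ] at this
    exact this.false
  have hAB : ∀ B ∈ RationalSubspaces n e, 0 < psi k A B := fun B hB => by
    rw [hψA B hB]
    exact angle_pos (by omega) (by rw [hB.2]; exact hle) (hirrA.1 h B hB)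
  have hJB : ∀ J : Finset (Fin d), J.card = l → ∀ B ∈ RationalSubspaces n e,
      0 < psi (l - g (Module.finrank ℝ (partialSum L J)) e n) (partialSum L J) B := by
    intro J hJ B hB
    rw [hψJ J hJ B hB]
    exact angle_pos (by rw [hfinJ, hJ]) (by rw [hB.2]; exact hle)
      ((hirrJ J hJ).1 (hAJirr h J hJ) B hB)
  obtain ⟨m, rfl⟩ : ∃ m, l = m + 1 := ⟨l - 1, by omega⟩
  have hlower : ∀ J : Finset (Fin d), J.card = m + 1 →
      exponent (partialSum L J) e (m + 1 - g (Module.finrank ℝ (partialSum L J)) e n)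
        ≤ exponent A e k := by
    intro J hJ
    -- The constant is the factor `l = m + 1` lost in `exists_le_of_angle`; here `B' = B`.
    have hm : (0 : ℝ) < (m + 1 : ℕ) := by positivity
    refine (exponent_le_iSup (ι := Unit) (A' := fun _ => A) (j' := fun _ => k) hm
      (fun B hB => ⟨(), B, hB, ?_, ?_⟩) fun _ => hAB).trans (iSup_const).le
    · refine le_mul_of_one_le_left (Real.sqrt_nonneg _) ?_
      exact_mod_cast hl1
    · rw [hψA B hB, hψJ J hJ B hB]
      obtain ⟨V, hVJ, hVl, hV⟩ := exists_le_of_angle (m + 1) (partialSum L J) B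
        (by rw [hfinJ, hJ]) (by rw [hB.2]; exact hle)
      exact angle_le_of_forall m A B V (hVJ.trans (hAJ J)) hVl.ge (by rw [hB.2]; exact hle) hV
  refine ⟨?_, ?_⟩
  · obtain ⟨J₀, -, hJ₀⟩ := Finset.exists_subset_card_eq (s := (Finset.univ : Finset (Fin d)))
      (n := m + 1) (by simpa using hld)
    have : Nonempty {J : Finset (Fin d) // J.card = m + 1} := ⟨⟨J₀, hJ₀⟩⟩
    -- The term `C * (m + 1)` bounds the angle after transfer, and the term `C` bounds the height.
    have hC' : 0 < C * (m + 1 : ℕ) + C := by positivity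
    have hupper := exponent_le_iSup (A := A) (j := k)
      (ι := {J : Finset (Fin d) // J.card = m + 1}) (A' := fun J => partialSum L J.1)
      (j' := fun J => m + 1 - g (Module.finrank ℝ (partialSum L J.1)) e n) hC'
      (fun B hB => by
        obtain ⟨V, hVA, hVl, hV⟩ := exists_le_of_angle (m + 1) A B (by omega)
          (by rw [hB.2]; exact hle)
        obtain ⟨J, hJ, B', hB', hh, hclose⟩ := htransfer B hB V (hA ▸ hVA) hVl
        have hang := angle_nonneg (m + 1) A B
        refine ⟨⟨J, hJ⟩, B', hB', hh.trans ?_, ?_⟩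
        · refine mul_le_mul_of_nonneg_right ?_ (Real.sqrt_nonneg _)
          linarith [mul_nonneg hC.le (Nat.cast_nonneg (α := ℝ) (m + 1))]
        · rw [hψA B hB, hψJ J hJ B' hB']
          refine (angle_le_of_forall m _ B' (partialSum L J) le_rfl (by rw [hfinJ, hJ])
            (by rw [hB'.2]; exact hle) (hclose _ (by positivity) hV)).trans ?_
          linarith [mul_nonneg hC.le hang])
      fun J => hJB J.1 J.2
    obtain ⟨J, hJ⟩ := exists_eq_ciSup_of_finite
      (f := fun J : {J : Finset (Fin d) // J.card = m + 1} =>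
        exponent (partialSum L J.1) e (m + 1 - g (Module.finrank ℝ (partialSum L J.1)) e n))
    exact ⟨J.1, J.2, le_antisymm (hupper.trans hJ.ge) (hlower J.1 J.2)⟩
  · rintro _ ⟨J, hJ, rfl⟩
    exact hlower J hJ
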